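/- **Setting.** All graphs are finite and simple, $d(\cdot,\cdot)$ is the shortest path distance in the graph, and homology has coefficients in $\mathbb{Z}/2$. *4-WL.* For $k\ge 2$, $k$-WL colours the $k$-tuples of vertices. The initial colour of $\vec v$ is its isomorphism type (which entries coincide, which are adjacent). In round $t$ the new colour of $\vec v$ is an injective encoding of its old colour and of the $k$ multisets (for $i=1,\dots,k$) of the old colours of all tuples obtained from $\vec v$ by replacing the $i$-th entry by an arbitrary vertex. $k$-WL distinguishes two graphs if after some round the multisets of colours of all $k$-tuples differ. *Pair vicinity graphs and filter.* For vertices $v_1,v_2$ of $G$ and $k\ge 1$, the $k$-hop vicinity graph $G^k_{v_1v_2}$ is the subgraph induced on $\{u : d(u,v_1)\le k,\ d(u,v_2)\le k\}$. A vertex $u$ gets the value $$f_{v_1v_2}(u)=1+\min(d(u,v_1),d(u,v_2))+\lfloor D/2\rfloor\big(\lfloor D/2\rfloor+(D \bmod 2)-1\big),\qquad D=d(u,v_1)+d(u,v_2).$$ In the ascending filtration an edge $uw$ has value $\max(f(u),f(w))$ if $f(u)\ne f(w)$, and $f(u)+\tfrac12$ otherwise; in the descending filtration it has value $\min(f(u),f(w))$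 if $f(u)\neq f(w)$, and $f(u)-\tfrac12$ otherwise. With $X_t$ the subcomplex of simplices of ascending value $\le t$ and $X^a$ that of simplices of descending value $\ge a$, the extended persistence diagram $\mathrm{EPD}_k(G;v_1,v_2)$ is the planar multiset of all birth–death pairs, in degrees $0$ and $1$, of the extended persistence module $H(X_t)\to\cdots\to H(X)\to\cdots\to H(X,X^a)$ ($t$ increasing, then $a$ decreasing) of $X=G^k_{v_1v_2}$. The diagrams of $k$-hop vicinity graphs distinguish $G$ and $H$ if the multisets $\{\!\!\{\mathrm{EPD}_k(G;v_1,v_2)\}\!\!\}$ and $\{\!\!\{\mathrm{EPD}_k(H;v_1,v_2)\}\!\!\}$ over all ordered pairs of vertices differ. *The graphs.* For $\ell\in\{0,1\}$ let $G^{(\ell)}$ have the vertices $u_{a,\vec v}$ with $a\in\{1,\dots,5\}$ and $\vec v\in\{0,1\}^4$, where $\vec v$ has an even number of ones if $a\le 5-\ell$ and an odd number of ones if $a\geq 6-\ell$. The vertices $u_{a,\vec v}$ and $u_{a',\vec v'}$ are adjacent iff there is $m\in\{1,2,3,4\}$ with $a'\equiv a+m \pmod 5$ and $v_m=v'_{5-m}$.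 (These are Cai–Fürer–Immerman type graphs over the complete graph $K_5$.) Put $G=G^{(0)}$ and $H=G^{(1)}$, and in each of them $v_1=u_{1,(0,0,0,0)}$, $v_2=u_{2,(0,0,0,0)}$. **Theorem.** With the pairwise distance filter, extended persistence diagrams of pair vicinity graphs distinguish some pair of graphs that 4-WL cannot distinguish. More precisely, $G$ and $H$ have $40$ vertices each and 4-WL does not distinguish them, whereas for every $k\ge 1$ the extended persistence diagrams of $k$-hop vicinity graphs distinguish $G$ and $H$; in particular $\mathrm{EPD}_k(G;v_1,v_2)\ne \mathrm{EPD}_k(H;v_1,v_2)$. In both graphs the vertices with filter value $f_{v_1v_2}=2$ are exactly the common neighbours of $v_1$ and $v_2$, and the subgraph induced on them has first Betti number $2$ in $G$ and $1$ in $H$. -/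

import Mathlib

noncomputable section

/-! ### The `k`-dimensional Weisfeiler–Leman test (for `k ≥ 2`) -/

/-- The colours available after `t` rounds of `k`-WL. The hash function is taken to be the
identity, so that two colours agree exactly when the hashed data agree. -/
def WLColor (k : ℕ) : ℕ → Type
  | 0 => (Fin k → Fin k → Prop) × (Fin k → Fin k → Prop)
  | t + 1 => WLColor k t × (Fin k → Multiset (WLColor k t))

/-- The colour of a `k`-tuple after `t` rounds. Initially it is the isomorphism type of the tuple:
which entries coincide, and which are adjacent. A round records, for each position `i`, the
multiset of the colours of all tuples obtained by replacing the `i`-th entry. -/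
def wlColor {V : Type*} [Fintype V] (G : SimpleGraph V) (k : ℕ) :
    (t : ℕ) → (Fin k → V) → WLColor k t
  | 0 => fun x => (fun i j => x i = x j, fun i j => G.Adj (x i) (x j))
  | t + 1 => fun x => (wlColor G k t x,
      fun i => (Finset.univ : Finset V).val.map fun w => wlColor G k t (Function.update x i w))

/-- The histogram of the colours of all `k`-tuples after `t` rounds. -/
def wlHistogram {V : Type*} [Fintype V] (G : SimpleGraph V) (k t : ℕ) : Multiset (WLColor k t) :=
  (Finset.univ : Finset (Fin k → V)).val.map (wlColor G k t)

/-- `k`-WL distinguishes `G` and `H`: after some number of rounds the histograms differ (they then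
differ in every later round, in particular once the colourings are stable). -/
def WLDistinguishes {V W : Type*} [Fintype V] [Fintype W] (k : ℕ)
    (G : SimpleGraph V) (H : SimpleGraph W) : Prop :=
  ∃ t, wlHistogram G k t ≠ wlHistogram H k t

/-! ### Relative homology of graphs, with coefficients in `ZMod 2`

A finite simple graph is a simplicial complex of dimension at most one, and its subcomplexes are
its subgraphs. -/

section Homology

variable {V : Type*} {G : SimpleGraph V}

/-- The `0`-chains of a subgraph. -/
def chains₀ (K : G.Subgraph) : Submodule (ZMod 2) (V → ZMod 2) where
  carrier := {c | ∀ v, v ∉ K.verts → c v = 0}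
  add_mem' ha hb v hv := by simp [ha v hv, hb v hv]
  zero_mem' _ _ := rfl
  smul_mem' r c hc v hv := by simp [hc v hv]

/-- The `1`-chains of a subgraph. -/
def chains₁ (K : G.Subgraph) : Submodule (ZMod 2) (Sym2 V → ZMod 2) where
  carrier := {c | ∀ e, e ∉ K.edgeSet → c e = 0}
  add_mem' ha hb e he := by simp [ha e he, hb e he]
  zero_mem' _ _ := rfl
  smul_mem' r c hc e he := by simp [hc e he]

/-- The boundary map: the coefficient of `v` in `∂c` is the sum of the coefficients in `c` of the
edges at `v`. -/
def boundary (V : Type*) [Fintype V] : (Sym2 V → ZMod 2) →ₗ[ZMod 2] (V → ZMod 2) where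
  toFun c v := ∑ w, c s(v, w)
  map_add' c c' := by ext v; simp [Finset.sum_add_distrib]
  map_smul' r c := by ext v; simp [Finset.mul_sum]

theorem chains₀_mono {K L : G.Subgraph} (h : K ≤ L) : chains₀ K ≤ chains₀ L :=
  fun _ hc v hv => hc v fun hv' => hv (h.1 hv')

theorem chains₁_mono {K L : G.Subgraph} (h : K ≤ L) : chains₁ K ≤ chains₁ L :=
  fun _ hc e he => hc e fun he' => he (SimpleGraph.Subgraph.edgeSet_mono h he')

/-- Relative `0`-cycles of the pair `(K, A)`: all `0`-chains of `K`. -/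
def relCycles₀ (P : G.Subgraph × G.Subgraph) : Submodule (ZMod 2) (V → ZMod 2) :=
  chains₀ P.1

/-- Relative `0`-boundaries of the pair `(K, A)`: boundaries of `1`-chains of `K`, up to
`0`-chains of `A`. -/
def relBoundaries₀ [Fintype V] (P : G.Subgraph × G.Subgraph) : Submodule (ZMod 2) (V → ZMod 2) :=
  (chains₁ P.1).map (boundary V) ⊔ chains₀ P.2

/-- Relative `1`-cycles of the pair `(K, A)`: `1`-chains of `K` whose boundary is a chain of `A`. -/
def relCycles₁ [Fintype V] (P : G.Subgraph × G.Subgraph) :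
    Submodule (ZMod 2) (Sym2 V → ZMod 2) :=
  chains₁ P.1 ⊓ (chains₀ P.2).comap (boundary V)

/-- Relative `1`-boundaries of the pair `(K, A)`: as there are no `2`-chains, the `1`-chains
of `A`. -/
def relBoundaries₁ (P : G.Subgraph × G.Subgraph) : Submodule (ZMod 2) (Sym2 V → ZMod 2) :=
  chains₁ P.2

/-- The quotient of cycles by boundaries. -/
abbrev HomologyQuot {M : Type*} [AddCommGroup M] [Module (ZMod 2) M]
    (Z B : Submodule (ZMod 2) M) : Type _ :=
  Z ⧸ B.submoduleOf Z

/-- The map between homology quotients induced by the inclusions of cycles and boundaries. -/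
def homologyMap {M : Type*} [AddCommGroup M] [Module (ZMod 2) M]
    {Z B Z' B' : Submodule (ZMod 2) M} (hZ : Z ≤ Z') (hB : B ≤ B') :
    HomologyQuot Z B →ₗ[ZMod 2] HomologyQuot Z' B' :=
  Submodule.mapQ _ _ (Submodule.inclusion hZ) fun _ hx => hB hx

theorem relCycles₀_mono {P Q : G.Subgraph × G.Subgraph} (h : P ≤ Q) :
    relCycles₀ P ≤ relCycles₀ Q :=
  chains₀_mono h.1

theorem relBoundaries₀_mono [Fintype V] {P Q : G.Subgraph × G.Subgraph} (h : P ≤ Q) :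
    relBoundaries₀ P ≤ relBoundaries₀ Q :=
  sup_le_sup (Submodule.map_mono (chains₁_mono h.1)) (chains₀_mono h.2)

theorem relCycles₁_mono [Fintype V] {P Q : G.Subgraph × G.Subgraph} (h : P ≤ Q) :
    relCycles₁ P ≤ relCycles₁ Q :=
  inf_le_inf (chains₁_mono h.1) (Submodule.comap_mono (chains₀_mono h.2))

theorem relBoundaries₁_mono {P Q : G.Subgraph × G.Subgraph} (h : P ≤ Q) :
    relBoundaries₁ P ≤ relBoundaries₁ Q :=
  chains₁_mono h.2

end Homology

/-- The first Betti number of a graph, i.e. the dimension of `H₁(G) = H₁(G, ∅)`. -/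
def bettiOne {V : Type*} [Fintype V] (G : SimpleGraph V) : ℕ :=
  Module.finrank (ZMod 2)
    (HomologyQuot (relCycles₁ ((⊤, ⊥) : G.Subgraph × G.Subgraph))
      (relBoundaries₁ ((⊤, ⊥) : G.Subgraph × G.Subgraph)))

/-! ### Extended persistence diagrams -/

section Persistence

variable {V : Type*} (G : SimpleGraph V) (f : V → ℝ)

/-- The value of the edge `uv` in the ascending filtration. -/
def ascEdge {V : Type*} (f : V → ℝ) (u v : V) : ℝ :=
  if f u = f v then f u + 1 / 2 else max (f u) (f v)

/-- The value of the edge `uv` in the descending filtration. -/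
def descEdge {V : Type*} (f : V → ℝ) (u v : V) : ℝ :=
  if f u = f v then f u - 1 / 2 else min (f u) (f v)

theorem le_ascEdge {V : Type*} (f : V → ℝ) (u v : V) : f u ≤ ascEdge f u v := by
  unfold ascEdge; split_ifs <;> simp

theorem descEdge_le {V : Type*} (f : V → ℝ) (u v : V) : descEdge f u v ≤ f u := by
  unfold descEdge; split_ifs <;> simp

theorem ascEdge_comm {V : Type*} (f : V → ℝ) (u v : V) : ascEdge f u v = ascEdge f v u := by
  unfold ascEdge
  by_cases h : f u = f v
  · simp [h]
  · rw [if_neg h, if_neg (Ne.symm h), max_comm]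

theorem descEdge_comm {V : Type*} (f : V → ℝ) (u v : V) : descEdge f u v = descEdge f v u := by
  unfold descEdge
  by_cases h : f u = f v
  · simp [h]
  · rw [if_neg h, if_neg (Ne.symm h), min_comm]

/-- The sublevel complex `X_t` of the ascending filtration. -/
def sublevel (t : ℝ) : G.Subgraph where
  verts := {v | f v ≤ t}
  Adj u v := G.Adj u v ∧ ascEdge f u v ≤ t
  adj_sub h := h.1
  edge_vert h := (le_ascEdge f _ _).trans h.2
  symm := ⟨fun u v h => ⟨h.1.symm, by rw [ascEdge_comm]; exact h.2⟩⟩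

/-- The superlevel complex `X^a` of the descending filtration. -/
def superlevel (a : ℝ) : G.Subgraph where
  verts := {v | a ≤ f v}
  Adj u v := G.Adj u v ∧ a ≤ descEdge f u v
  adj_sub h := h.1
  edge_vert h := h.2.trans (descEdge_le f _ _)
  symm := ⟨fun u v h => ⟨h.1.symm, by rw [descEdge_comm]; exact h.2⟩⟩

/-- The index set of extended persistence: first the real line in its usual order (ascending part),
then the real line in the opposite order (descending part). -/
abbrev ExtIndex : Type := ℝ ⊕ₗ ℝᵒᵈ

/-- The index of the threshold `t` of the ascending part. -/
def up (t : ℝ) : ExtIndex := Sum.inlₗ t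

/-- The index of the threshold `a` of the descending part. -/
def down (a : ℝ) : ExtIndex := Sum.inrₗ (OrderDual.toDual a)

/-- The pair of complexes at an index: `(X_t, ∅)` in the ascending part, and `(X, X^a)` in the
descending part. -/
def extPair (s : ExtIndex) : G.Subgraph × G.Subgraph :=
  Sum.elim (fun t : ℝ => (sublevel G f t, ⊥))
    (fun a : ℝᵒᵈ => (⊤, superlevel G f (OrderDual.ofDual a))) (ofLex s)

theorem extPair_mono : Monotone (extPair G f) := by
  intro s s' h
  rw [← toLex_ofLex s, ← toLex_ofLex s'] at h
  rcases hs : ofLex s with t | a <;> rcases hs' : ofLex s' with t' | a' <;>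
    rw [hs, hs'] at h <;> simp only [extPair, hs, hs', Sum.elim_inl, Sum.elim_inr]
  · have h' : t ≤ t' := Sum.Lex.inl_le_inl_iff.1 h
    exact ⟨⟨fun v hv => le_trans hv h', fun u v huv => ⟨huv.1, huv.2.trans h'⟩⟩, le_rfl⟩
  · exact ⟨le_top, bot_le⟩
  · exact absurd h Sum.Lex.not_inr_le_inl
  · have h₁ : a ≤ a' := Sum.Lex.inr_le_inr_iff.1 h
    have h' : OrderDual.ofDual a' ≤ OrderDual.ofDual a := h₁
    exact ⟨le_rfl, ⟨fun v hv => le_trans h' hv, fun u v huv => ⟨huv.1, h'.trans huv.2⟩⟩⟩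

/-- The rank of the map `s → s'` in the degree `0` extended persistence module. -/
def extRank₀ [Fintype V] (s s' : ExtIndex) (h : s ≤ s') : ℕ :=
  Module.finrank (ZMod 2) (LinearMap.range (homologyMap
    (relCycles₀_mono (extPair_mono G f h)) (relBoundaries₀_mono (extPair_mono G f h))))

/-- The rank of the map `s → s'` in the degree `1` extended persistence module. -/
def extRank₁ [Fintype V] (s s' : ExtIndex) (h : s ≤ s') : ℕ :=
  Module.finrank (ZMod 2) (LinearMap.range (homologyMap
    (relCycles₁_mono (extPair_mono G f h)) (relBoundaries₁_mono (extPair_mono G f h))))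

/-- The number of classes that are born exactly at `b` and die exactly at `d`, for a persistence
module with ranks `β`. For `s < b ≤ s' < d`, the number of classes born in `(s, b]` and dying in
`(s', d]` is `β b s' - β s s' - β b d + β s d`, and the multiplicity of `(b, d)` is the value of
this number for `s` close to `b` and `s'` close to `d`, i.e. its infimum. It is `0` if `d ≤ b`. -/
def pointMultiplicity (β : (s s' : ExtIndex) → s ≤ s' → ℕ) (b d : ExtIndex) : ℕ :=
  ⨅ q : Set.Iio b × Set.Ico b d,
    (β b q.2 q.2.2.1 + β q.1 d (q.1.2.le.trans (q.2.2.1.trans q.2.2.2.le))) -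
      (β q.1 q.2 (q.1.2.le.trans q.2.2.1) + β b d (q.2.2.1.trans q.2.2.2.le))

/-- The extended persistence diagram of `G` with node filter function `f`: a planar multiset,
given by its multiplicities. It combines, in degrees `0` and `1`, the points with birth and death
both in the ascending part, with birth in the ascending and death in the descending part, and with
birth and death both in the descending part. -/
def extPersistenceDiagram [Fintype V] (x : ℝ × ℝ) : ℕ :=
  (pointMultiplicity (extRank₀ G f) (up x.1) (up x.2) +
    pointMultiplicity (extRank₀ G f) (up x.1) (down x.2) +
    pointMultiplicity (extRank₀ G f) (down x.1) (down x.2)) +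
  (pointMultiplicity (extRank₁ G f) (up x.1) (up x.2) +
    pointMultiplicity (extRank₁ G f) (up x.1) (down x.2) +
    pointMultiplicity (extRank₁ G f) (down x.1) (down x.2))

end Persistence

/-! ### Vicinity graphs of pairs of nodes and the distance filter function -/

/-- The nodes within `k` hops of both `v₁` and `v₂`. -/
def vicinity {V : Type*} (G : SimpleGraph V) (k : ℕ) (v₁ v₂ : V) : Set V :=
  {u | G.edist u v₁ ≤ k ∧ G.edist u v₂ ≤ k}

/-- The real encoding of the label `(d(u, v₁), d(u, v₂))`, with `/` and `%` the integer quotient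
and remainder. -/
def pairFilter {V : Type*} (G : SimpleGraph V) (v₁ v₂ u : V) : ℝ :=
  let d := G.dist u v₁ + G.dist u v₂
  1 + (min (G.dist u v₁) (G.dist u v₂) : ℕ) +
    ((d / 2 : ℕ) : ℝ) * (((d / 2 : ℕ) : ℝ) + ((d % 2 : ℕ) : ℝ) - 1)

open Classical in
/-- The extended persistence diagram of the `k`-hop vicinity graph of `(v₁, v₂)` (the subgraph
induced on the vicinity) with respect to the distance filter function. -/
def pairDiagram {V : Type*} [Fintype V] (G : SimpleGraph V) (k : ℕ) (v₁ v₂ : V) : ℝ × ℝ → ℕ :=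
  extPersistenceDiagram (G.induce (vicinity G k v₁ v₂)) fun u => pairFilter G v₁ v₂ u

/-- The diagrams of the `k`-hop vicinity graphs distinguish `G` and `H`: the multisets of the
diagrams over all pairs of nodes differ. -/
def DiagramsDistinguish {V W : Type*} [Fintype V] [Fintype W] (k : ℕ)
    (G : SimpleGraph V) (H : SimpleGraph W) : Prop :=
  ((Finset.univ : Finset (V × V)).val.map fun p => pairDiagram G k p.1 p.2) ≠
    ((Finset.univ : Finset (W × W)).val.map fun p => pairDiagram H k p.1 p.2)

/-- The nodes with filter value `2`. -/
def layerTwo {V : Type*} (G : SimpleGraph V) (v₁ v₂ : V) : Set V :=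
  {u | pairFilter G v₁ v₂ u = 2}

open Classical in
/-- The first Betti number of the subgraph induced on the nodes with filter value `2`. -/
def layerBetti {V : Type*} [Fintype V] (G : SimpleGraph V) (v₁ v₂ : V) : ℕ :=
  bettiOne (G.induce (layerTwo G v₁ v₂))

/-! ### The Cai–Fürer–Immerman type graphs over the complete graph on five nodes -/

/-- The nodes `u_{a, v}` of the `ℓ`-th graph: `v` has an odd number of ones for the last `ℓ`
values of `a`, and an even number of ones for the others. The indices `a ∈ {1, …, 5}` and
`m ∈ {1, …, 4}` are shifted to start at `0`. -/
abbrev CFINode (ℓ : ℕ) : Type :=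
  {x : Fin 5 × (Fin 4 → Bool) //
    (Finset.univ.filter fun m => x.2 m = true).card % 2 = if 5 ≤ x.1.val + ℓ then 1 else 0}

/-- Two nodes `u_{a, v}` and `u_{a', v'}` are adjacent iff there is `m ∈ {1, …, 4}` with
`a' ≡ a + m` modulo `5` and `v_m = v'_{5-m}`. -/
def cfiGraph (ℓ : ℕ) : SimpleGraph (CFINode ℓ) where
  Adj x y := ∃ m : Fin 4, y.1.1.val % 5 = (x.1.1.val + (m.val + 1)) % 5 ∧ x.1.2 m = y.1.2 m.rev
  symm := ⟨by
    rintro x y ⟨m, h, h'⟩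
    refine ⟨m.rev, ?_, by rw [Fin.rev_rev]; exact h'.symm⟩
    rw [Fin.val_rev]
    omega⟩
  loopless := ⟨by
    rintro x ⟨m, h, -⟩
    omega⟩

/-- The node `u_{1, (0,0,0,0)}`, for `ℓ ≤ 3`. -/
def cfiTarget₁ (ℓ : ℕ) (h : ℓ ≤ 3) : CFINode ℓ :=
  ⟨(0, fun _ => false), by simp; omega⟩

/-- The node `u_{2, (0,0,0,0)}`, for `ℓ ≤ 3`. -/
def cfiTarget₂ (ℓ : ℕ) (h : ℓ ≤ 3) : CFINode ℓ :=
  ⟨(1, fun _ => false), by simp; omega⟩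

end

/-! A node over the base vertex `a` carries one bit in `ZMod 2` for each base edge at `a`, with
prescribed sum; two nodes over different base vertices are adjacent iff their bits on the common
base edge agree. Changing both bits on a base edge is a flip. Flips preserve adjacency and change
the parity at the two ends of the edge, so the total parity, the only difference between the graphs,
is a defect that can be moved around but not removed.

4-WL cannot find the defect. Four nodes lie over at most four of the five base vertices, so the
defect can sit over a free one, where the tuple does not see it (`FlipRelated`). When an entry is
replaced, a bijection of the nodes respects this invariant, if necessary moving the defect to
another free base vertex (`FlipRelated.exists_equiv`). Hence related tuples have equal colours in
all rounds.

The diagrams do find it. For an integer-valued filter, the edges with ascending value at most 5/2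
and descending value at least 3/2 are exactly those inside the layer of value 2, so the multiplicity
of (5/2, 3/2) is the first Betti number of that layer (`extPersistenceDiagram_layerTwo`). For
adjacent `x`, `y` the layer is the set of common neighbours. It has two nodes over each of the three
other base vertices and is 2-regular, as three bits and the parity determine a node. A triangle in
it would complete `x`, `y` to a 5-clique. Summing all bits of such a clique counts each base edge
twice, so the total parity would be 0: impossible in the twisted graph (`not_five_clique`). So there
the layer is always one hexagon, while for the untwisted targets it is two triangles.

To compare whole multisets, the targets must not be matched with a non-adjacent pair of the twisted
graph; the point (1, 3/2), which is present iff the pair is adjacent, rules this out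
(`pairDiagram_one_ne_zero_iff`). -/

/-! ### Nodes of the CFI graphs through their bits -/

section Bits

variable {ℓ ℓ' : ℕ}

/-- The prescribed parity of the fibre over `a`. -/
def fibreParity (ℓ : ℕ) (a : Fin 5) : ZMod 2 := if 5 ≤ a.val + ℓ then 1 else 0

/-- The base vertex below a node. -/
def fibre (x : CFINode ℓ) : Fin 5 := x.1.1

/-- The coordinate at the base vertex `a` that belongs to the base edge from `a` to `t`. -/
def slot (a t : Fin 5) : Fin 4 := Fin.ofNat 4 ((t.val + 4 - a.val) % 5)

/-- The base vertex to which the `m`-th coordinate at `a` points. -/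
def slotTarget (a : Fin 5) (m : Fin 4) : Fin 5 := Fin.ofNat 5 (a.val + (m.val + 1))

/-- The coordinate of a node in the direction of the base vertex `t`, and `0` at its own base
vertex. -/
def bit (x : CFINode ℓ) (t : Fin 5) : ZMod 2 :=
  if t ≠ fibre x ∧ x.1.2 (slot (fibre x) t) = true then 1 else 0

theorem slot_slotTarget : ∀ a m, slot a (slotTarget a m) = m := by decide

theorem slotTarget_slot : ∀ a t, t ≠ a → slotTarget a (slot a t) = t := by decide

theorem slotTarget_ne : ∀ a m, slotTarget a m ≠ a := by decide

theorem slot_rev : ∀ a t : Fin 5, t ≠ a → (slot a t).rev = slot t a := by decide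

theorem slotTarget_eq_iff : ∀ (a t : Fin 5) (m : Fin 4),
    t.val % 5 = (a.val + (m.val + 1)) % 5 ↔ t = slotTarget a m := by decide

theorem bit_self (x : CFINode ℓ) : bit x (fibre x) = 0 := by simp [bit]

theorem bit_slotTarget (x : CFINode ℓ) (m : Fin 4) :
    bit x (slotTarget (fibre x) m) = if x.1.2 m = true then 1 else 0 := by
  simp [bit, slotTarget_ne, slot_slotTarget]

theorem sum_eq_sum_slotTarget (b : Fin 5 → ZMod 2) (a : Fin 5) (h : b a = 0) :
    ∑ t, b t = ∑ m, b (slotTarget a m) := by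
  have himage : ∀ a, Finset.univ.erase a = Finset.univ.image (slotTarget a) := by decide
  have hinj : ∀ a, Function.Injective (slotTarget a) := fun a m m' e => by
    rw [← slot_slotTarget a m, e, slot_slotTarget]
  rw [← Finset.add_sum_erase _ _ (Finset.mem_univ a), h, zero_add, himage,
    Finset.sum_image fun _ _ _ _ e => hinj a e]

theorem natCast_eq_fibreParity_iff (n : ℕ) (a : Fin 5) :
    (n : ZMod 2) = fibreParity ℓ a ↔ n % 2 = if 5 ≤ a.val + ℓ then 1 else 0 := by
  unfold fibreParity
  split_ifs with h
  · rw [ZMod.natCast_eq_one_iff_odd, Nat.odd_iff]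
  · rw [ZMod.natCast_eq_zero_iff_even, Nat.even_iff]

theorem natCast_card_filter (v : Fin 4 → Bool) :
    (((Finset.univ.filter fun m => v m = true).card : ℕ) : ZMod 2) =
      ∑ m, if v m = true then 1 else 0 := by
  simp

theorem sum_bit (x : CFINode ℓ) : ∑ t, bit x t = fibreParity ℓ (fibre x) := by
  rw [sum_eq_sum_slotTarget _ _ (bit_self x)]
  simp only [bit_slotTarget]
  rw [← natCast_card_filter, natCast_eq_fibreParity_iff]
  exact x.2

theorem node_ext {x y : CFINode ℓ} (h : fibre x = fibre y) (hb : ∀ t, bit x t = bit y t) :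
    x = y := by
  refine Subtype.ext (Prod.ext h (funext fun m => ?_))
  have h1 := hb (slotTarget (fibre x) m)
  rw [bit_slotTarget, h, bit_slotTarget] at h1
  by_cases hx : x.1.2 m = true <;> by_cases hy : y.1.2 m = true <;> simp_all

theorem exists_node (a : Fin 5) (b : Fin 5 → ZMod 2) (h : b a = 0)
    (hs : ∑ t, b t = fibreParity ℓ a) :
    ∃ x : CFINode ℓ, fibre x = a ∧ ∀ t, bit x t = b t := by
  have h2 : ∀ z : ZMod 2, (if z = 1 then (1 : ZMod 2) else 0) = z := by decide
  refine ⟨⟨(a, fun m => decide (b (slotTarget a m) = 1)), ?_⟩, rfl, fun t => ?_⟩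
  · rw [← natCast_eq_fibreParity_iff, natCast_card_filter, ← hs, sum_eq_sum_slotTarget b a h]
    simp [h2]
  · by_cases ht : t = a
    · subst ht
      rw [h]
      exact bit_self _
    · have := h2 (b t)
      simp [bit, fibre, ht, slotTarget_slot a t ht, this]

/-- Reversing a coordinate index looks at the same base edge from its other end (`slot_rev`), so
adjacency compares the two bits attached to one base edge. -/
theorem cfiGraph_adj_iff (x y : CFINode ℓ) :
    (cfiGraph ℓ).Adj x y ↔ fibre y ≠ fibre x ∧ bit x (fibre y) = bit y (fibre x) := by
  have key : (cfiGraph ℓ).Adj x y ↔ ∃ m : Fin 4, fibre y = slotTarget (fibre x) m ∧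
      x.1.2 m = y.1.2 m.rev := by
    simp only [← slotTarget_eq_iff]
    rfl
  rw [key]
  constructor
  · rintro ⟨m, h, h'⟩
    have hne : fibre y ≠ fibre x := h ▸ slotTarget_ne _ _
    have hm : slot (fibre x) (fibre y) = m := by rw [h, slot_slotTarget]
    refine ⟨hne, ?_⟩
    simp only [bit, hne, hne.symm, ne_eq, not_false_eq_true, true_and, hm,
      ← slot_rev _ _ hne, h']
  · rintro ⟨hne, h⟩
    refine ⟨slot (fibre x) (fibre y), (slotTarget_slot _ _ hne).symm, ?_⟩
    simp only [bit, hne, hne.symm, ne_eq, not_false_eq_true, true_and,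
      ← slot_rev _ _ hne] at h
    revert h
    cases x.1.2 (slot (fibre x) (fibre y)) <;>
      cases y.1.2 (slot (fibre x) (fibre y)).rev <;> simp

/-- Adding the row `h (fibre x)` to the bits of `x` gives a node of the other graph if the rows of
`h` have the right parities. -/
theorem exists_flip (h : Fin 5 → Fin 5 → ZMod 2) (h0 : ∀ a, h a a = 0)
    (hs : ∀ a, ∑ t, h a t = fibreParity ℓ a + fibreParity ℓ' a) (x : CFINode ℓ) :
    ∃ y : CFINode ℓ', fibre y = fibre x ∧ ∀ t, bit y t = bit x t + h (fibre x) t := by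
  refine exists_node _ _ (by simp [h0, bit_self]) ?_
  rw [Finset.sum_add_distrib, sum_bit, hs, ← add_assoc, CharTwo.add_self_eq_zero, zero_add]

/-- The bijection between the nodes of two CFI graphs that adds the rows of `h` to the bits. -/
noncomputable def flipEquiv (h : Fin 5 → Fin 5 → ZMod 2) (h0 : ∀ a, h a a = 0)
    (hs : ∀ a, ∑ t, h a t = fibreParity ℓ a + fibreParity ℓ' a) : CFINode ℓ ≃ CFINode ℓ' where
  toFun x := (exists_flip h h0 hs x).choose
  invFun y := (exists_flip (ℓ' := ℓ) h h0 (fun a => (hs a).trans (add_comm _ _)) y).choose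
  left_inv x := by
    obtain ⟨h1, h2⟩ := (exists_flip h h0 hs x).choose_spec
    obtain ⟨h3, h4⟩ := (exists_flip (ℓ' := ℓ) h h0 (fun a => (hs a).trans (add_comm _ _))
      (exists_flip h h0 hs x).choose).choose_spec
    refine node_ext (h3.trans h1) fun t => ?_
    rw [h4, h2, h1, add_assoc, CharTwo.add_self_eq_zero, add_zero]
  right_inv y := by
    have hs' := fun a => (hs a).trans (add_comm _ _)
    obtain ⟨h1, h2⟩ := (exists_flip (ℓ' := ℓ) h h0 hs' y).choose_spec
    obtain ⟨h3, h4⟩ := (exists_flip (ℓ' := ℓ') h h0 hs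
      (exists_flip (ℓ' := ℓ) h h0 hs' y).choose).choose_spec
    refine node_ext (h3.trans h1) fun t => ?_
    rw [h4, h2, h1, add_assoc, CharTwo.add_self_eq_zero, add_zero]

theorem fibre_flipEquiv (h : Fin 5 → Fin 5 → ZMod 2) (h0 : ∀ a, h a a = 0)
    (hs : ∀ a, ∑ t, h a t = fibreParity ℓ a + fibreParity ℓ' a) (x : CFINode ℓ) :
    fibre (flipEquiv h h0 hs x) = fibre x :=
  (exists_flip h h0 hs x).choose_spec.1

theorem bit_flipEquiv (h : Fin 5 → Fin 5 → ZMod 2) (h0 : ∀ a, h a a = 0)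
    (hs : ∀ a, ∑ t, h a t = fibreParity ℓ a + fibreParity ℓ' a) (x : CFINode ℓ) (t : Fin 5) :
    bit (flipEquiv h h0 hs x) t = bit x t + h (fibre x) t :=
  (exists_flip h h0 hs x).choose_spec.2 t

end Bits

/-! ### The pebble game invariant -/

section WeisfeilerLeman

variable {ℓ ℓ' : ℕ}

theorem map_univ_val_equiv {α β γ : Type*} [Fintype α] [Fintype β] (e : α ≃ β) (f : α → γ)
    (g : β → γ) (h : ∀ a, f a = g (e a)) :
    (Finset.univ : Finset α).val.map f = (Finset.univ : Finset β).val.map g := by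
  rw [← Finset.map_univ_equiv e, Finset.map_val, Multiset.map_map]
  exact Multiset.map_congr rfl fun a _ => h a

/-- The tuples `x` and `y` correspond to each other under the flips along the base edges selected
by `g`, which turn the parities of `ℓ` into those of `ℓ'` except at a base vertex `c` whose fibre
the tuples avoid. -/
def FlipRelated (x : Fin 4 → CFINode ℓ) (y : Fin 4 → CFINode ℓ') : Prop :=
  ∃ (c : Fin 5) (g : Fin 5 → Fin 5 → ZMod 2), (∀ a t, g a t = g t a) ∧ (∀ a, g a a = 0) ∧
    (∀ a, ∑ t, g a t = fibreParity ℓ a + fibreParity ℓ' a + if a = c then 1 else 0) ∧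
    ∀ i, fibre (x i) ≠ c ∧ fibre (y i) = fibre (x i) ∧
      ∀ t, bit (y i) t = bit (x i) t + g (fibre (x i)) t

/-- Since `g` is symmetric, the two bits compared by an adjacency are shifted by the same amount;
equality of entries survives because the shift depends on the fibre alone. -/
theorem FlipRelated.wlColor_zero {x : Fin 4 → CFINode ℓ} {y : Fin 4 → CFINode ℓ'}
    (h : FlipRelated x y) :
    wlColor (cfiGraph ℓ) 4 0 x = wlColor (cfiGraph ℓ') 4 0 y := by
  obtain ⟨c, g, hsym, -, -, hxy⟩ := h
  refine Prod.ext ?_ ?_ <;> funext i j <;> apply propext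
  · change x i = x j ↔ y i = y j
    constructor <;> intro e
    · refine node_ext (by rw [(hxy i).2.1, (hxy j).2.1, e]) fun t => ?_
      rw [(hxy i).2.2, (hxy j).2.2, e]
    · have hf : fibre (x i) = fibre (x j) := by rw [← (hxy i).2.1, ← (hxy j).2.1, e]
      refine node_ext hf fun t => ?_
      have h1 := (hxy i).2.2 t
      rw [e, (hxy j).2.2, hf] at h1
      exact (add_right_cancel h1).symm
  · change (cfiGraph ℓ).Adj (x i) (x j) ↔ (cfiGraph ℓ').Adj (y i) (y j)
    rw [cfiGraph_adj_iff, cfiGraph_adj_iff, (hxy i).2.1, (hxy j).2.1, (hxy i).2.2, (hxy j).2.2,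
      hsym (fibre (x i)), add_left_inj]

theorem exists_base_avoiding (p : Fin 4 → Fin 5) (i : Fin 4) (c : Fin 5) :
    ∃ c', c' ≠ c ∧ ∀ j, j ≠ i → p j ≠ c' := by
  -- Putting `c` in the `i`-th place merges both conditions into avoiding four values among five.
  have hcard : (Finset.univ.image (Function.update p i c)).card <
      (Finset.univ : Finset (Fin 5)).card :=
    lt_of_le_of_lt Finset.card_image_le (by decide)
  obtain ⟨c', -, hc'⟩ := Finset.exists_mem_notMem_of_card_lt_card hcard
  simp only [Finset.mem_image, Finset.mem_univ, true_and, not_exists] at hc'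
  refine ⟨c', fun h => hc' i (by simp [h]), fun j hj h => hc' j (by simp [hj, h])⟩

/-- Duplicator's answer in the pebble game. The remaining entries leave a base vertex `c' ≠ c` free.
If the new entry avoids the fibre of `c`, the old flips still serve; if it lies over `c`, a further
flip along the base edge from `c` to `c'` moves the defect to `c'` without affecting the remaining
entries. -/
theorem FlipRelated.exists_equiv {x : Fin 4 → CFINode ℓ} {y : Fin 4 → CFINode ℓ'}
    (h : FlipRelated x y) (i : Fin 4) :
    ∃ e : CFINode ℓ ≃ CFINode ℓ', ∀ w,
      FlipRelated (Function.update x i w) (Function.update y i (e w)) := by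
  obtain ⟨c, g, hsym, h0, hs, hxy⟩ := h
  obtain ⟨c', hcc', hc'⟩ := exists_base_avoiding (fun j => fibre (x j)) i c
  let δ : Fin 5 → Fin 5 → ZMod 2 :=
    fun a t => if (a = c ∧ t = c') ∨ (a = c' ∧ t = c) then 1 else 0
  have hδ0 : ∀ a, δ a a = 0 := by
    intro a
    simp only [δ]
    rw [if_neg]
    rintro (⟨rfl, h⟩ | ⟨rfl, h⟩)
    exacts [hcc' h.symm, hcc' h]
  have hδsym : ∀ a t, δ a t = δ t a := by
    intro a t
    simp only [δ]
    exact if_congr (by tauto) rfl rfl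
  have hδother : ∀ a t, a ≠ c → a ≠ c' → δ a t = 0 := by
    intro a t h1 h2
    simp [δ, h1, h2]
  have hδs : ∀ a, ∑ t, δ a t = (if a = c then 1 else 0) + if a = c' then 1 else 0 := by
    intro a
    by_cases h1 : a = c
    · subst h1
      simp [δ, hcc'.symm]
    · by_cases h2 : a = c'
      · subst h2
        simp [δ, hcc']
      · simp [δ, h1, h2]
  -- One bijection must serve both cases: over `c` it uses the moved flips, elsewhere the old ones.
  -- Its rows have the right parity everywhere; symmetry is needed only of the flips `g` and `g +
  -- δ`.
  let f : Fin 5 → Fin 5 → ZMod 2 := fun a t => if a = c then g a t + δ a t else g a t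
  have hf0 : ∀ a, f a a = 0 := by
    intro a
    simp only [f]
    split_ifs <;> simp [h0, hδ0]
  have hfs : ∀ a, ∑ t, f a t = fibreParity ℓ a + fibreParity ℓ' a := by
    intro a
    by_cases ha : a = c
    · subst ha
      simp only [f, if_true, Finset.sum_add_distrib, hs, hδs, hcc'.symm, if_false, add_zero]
      rw [add_assoc, CharTwo.add_self_eq_zero, add_zero]
    · simp only [f, if_neg ha, hs, add_zero]
  refine ⟨flipEquiv f hf0 hfs, fun w => ?_⟩
  by_cases hw : fibre w = c
  · refine ⟨c', fun a t => g a t + δ a t, fun a t => by simp only [hsym a t, hδsym a t],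
      fun a => by simp only [h0, hδ0, add_zero], fun a => ?_, fun j => ?_⟩
    · simp only [Finset.sum_add_distrib, hs, hδs]
      rw [add_add_add_comm, add_assoc, ← add_assoc (if a = c then (1 : ZMod 2) else 0)]
      rw [add_comm (if a = c then (1 : ZMod 2) else 0)]
      split_ifs <;> simp_all [CharTwo.add_self_eq_zero]
    · by_cases hj : j = i
      · subst hj
        simp only [Function.update_self]
        refine ⟨hw ▸ hcc'.symm, fibre_flipEquiv _ _ _ _, fun t => ?_⟩
        rw [bit_flipEquiv]
        simp [f, hw]
      · simp only [Function.update_of_ne hj]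
        refine ⟨hc' j hj, (hxy j).2.1, fun t => ?_⟩
        rw [(hxy j).2.2, hδother _ _ (hxy j).1 (hc' j hj), add_zero]
  · refine ⟨c, g, hsym, h0, hs, fun j => ?_⟩
    by_cases hj : j = i
    · subst hj
      simp only [Function.update_self]
      refine ⟨hw, fibre_flipEquiv _ _ _ _, fun t => ?_⟩
      rw [bit_flipEquiv]
      simp [f, hw]
    · simp only [Function.update_of_ne hj]
      exact hxy j

theorem FlipRelated.wlColor_eq (t : ℕ) {x : Fin 4 → CFINode ℓ} {y : Fin 4 → CFINode ℓ'}
    (h : FlipRelated x y) :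
    wlColor (cfiGraph ℓ) 4 t x = wlColor (cfiGraph ℓ') 4 t y := by
  induction t generalizing x y with
  | zero => exact h.wlColor_zero
  | succ t ih =>
    refine Prod.ext (ih h) (funext fun i => ?_)
    obtain ⟨e, he⟩ := h.exists_equiv i
    exact map_univ_val_equiv e _ _ fun w => ih (he w)

/-- Flips along the base edge from `c` to the last base vertex. -/
def edgeFlip (c a t : Fin 5) : ZMod 2 := if (a = 4 ∧ t = c ∨ a = c ∧ t = 4) ∧ a ≠ t then 1 else 0

/-- The rows of `edgeFlip c`, with the row `c` replaced by one with the right parity. -/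
def nodeFlip (c a t : Fin 5) : ZMod 2 :=
  if a = c then (if c = 4 ∧ t = 0 then 1 else 0) else edgeFlip c a t

theorem fibreParity_zero_add_one : ∀ a : Fin 5,
    fibreParity 0 a + fibreParity 1 a = if a = 4 then 1 else 0 := by decide

/-- The free base vertex is chosen from the fibres of the tuple only. Flips preserve fibres, so the
inverse recovers the same choice. -/
theorem exists_tuple_equiv : ∃ e : (Fin 4 → CFINode 0) ≃ (Fin 4 → CFINode 1),
    ∀ x, FlipRelated x (e x) := by
  have hf0 : ∀ c a, nodeFlip c a a = 0 := by decide
  have hfs : ∀ c a, ∑ t, nodeFlip c a t = fibreParity 0 a + fibreParity 1 a := by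
    simp only [fibreParity_zero_add_one]
    decide
  have hav : ∀ p : Fin 4 → Fin 5, ∃ c, ∀ j, p j ≠ c := by
    intro p
    obtain ⟨c, h1, h2⟩ := exists_base_avoiding p 0 (p 0)
    exact ⟨c, fun j => if hj : j = 0 then hj ▸ h1.symm else h2 j hj⟩
  choose c hc using hav
  let φ : (p : Fin 4 → Fin 5) → CFINode 0 ≃ CFINode 1 :=
    fun p => flipEquiv (nodeFlip (c p)) (hf0 _) (hfs _)
  have hφ : ∀ p w, fibre (φ p w) = fibre w := fun p w => fibre_flipEquiv _ _ _ _
  have hφ' : ∀ p w, fibre ((φ p).symm w) = fibre w := fun p w => by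
    rw [← hφ p, Equiv.apply_symm_apply]
  refine ⟨⟨fun x i => φ (fibre ∘ x) (x i), fun y i => (φ (fibre ∘ y)).symm (y i), ?_, ?_⟩, ?_⟩
  · intro x
    funext i
    have : (fibre ∘ fun i => φ (fibre ∘ x) (x i)) = fibre ∘ x := funext fun j => hφ _ _
    simp only [this, Equiv.symm_apply_apply]
  · intro y
    funext i
    have : (fibre ∘ fun i => (φ (fibre ∘ y)).symm (y i)) = fibre ∘ y := funext fun j => hφ' _ _
    simp only [this, Equiv.apply_symm_apply]
  · intro x
    refine ⟨c (fibre ∘ x), edgeFlip (c (fibre ∘ x)), ?_, ?_, ?_, fun i => ?_⟩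
    · generalize c (fibre ∘ x) = c
      revert c
      decide
    · generalize c (fibre ∘ x) = c
      revert c
      decide
    · simp only [fibreParity_zero_add_one]
      generalize c (fibre ∘ x) = c
      revert c
      decide
    · have hi : fibre (x i) ≠ c (fibre ∘ x) := hc (fibre ∘ x) i
      refine ⟨hi, hφ _ _, fun t => ?_⟩
      refine (bit_flipEquiv _ (hf0 _) (hfs _) _ t).trans ?_
      simp [nodeFlip, hi]

theorem not_wlDistinguishes_cfiGraph : ¬ WLDistinguishes 4 (cfiGraph 0) (cfiGraph 1) := by
  rintro ⟨t, ht⟩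
  obtain ⟨e, he⟩ := exists_tuple_equiv
  exact ht (map_univ_val_equiv e _ _ fun x => (he x).wlColor_eq t)

end WeisfeilerLeman

/-! ### Ranks in extended persistence modules -/

section Rank

open Module

/-- The image is that of `Z` in `Z' / B'`, and the kernel of `Z → Z' / B'` is `Z ⊓ B'`. All ranks
thereby reduce to cycles at the source and boundaries at the target. -/
theorem finrank_range_homologyMap {M : Type*} [AddCommGroup M] [Module (ZMod 2) M]
    [Module.Finite (ZMod 2) M] {Z B Z' B' : Submodule (ZMod 2) M} (hZ : Z ≤ Z') (hB : B ≤ B') :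
    finrank (ZMod 2) (LinearMap.range (homologyMap hZ hB)) =
      finrank (ZMod 2) Z - finrank (ZMod 2) ↥(Z ⊓ B') := by
  let L : Z →ₗ[ZMod 2] HomologyQuot Z' B' :=
    (B'.submoduleOf Z').mkQ ∘ₗ Submodule.inclusion hZ
  have h1 : LinearMap.range (homologyMap hZ hB) = LinearMap.range L := by
    rw [LinearMap.range_comp]
    exact Submodule.range_mapQ _ _ _ _
  have h2 : LinearMap.ker L = B'.comap Z.subtype := by
    ext z
    simp only [L, LinearMap.mem_ker, LinearMap.comp_apply, Submodule.mkQ_apply,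
      Submodule.Quotient.mk_eq_zero]
    rfl
  have h3 : finrank (ZMod 2) (LinearMap.ker L) = finrank (ZMod 2) ↥(Z ⊓ B') := by
    rw [h2, ← Submodule.map_comap_subtype, Submodule.finrank_map_subtype_eq]
  have h4 := L.finrank_range_add_finrank_ker
  rw [h1, ← h3]
  omega

variable {V : Type*} [Fintype V] (G : SimpleGraph V) (f : V → ℝ)

theorem extRank₀_eq (s s' : ExtIndex) (h : s ≤ s') : extRank₀ G f s s' h =
    finrank (ZMod 2) (relCycles₀ (extPair G f s)) -
      finrank (ZMod 2) ↥(relCycles₀ (extPair G f s) ⊓ relBoundaries₀ (extPair G f s')) :=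
  finrank_range_homologyMap _ _

theorem extRank₁_eq (s s' : ExtIndex) (h : s ≤ s') : extRank₁ G f s s' h =
    finrank (ZMod 2) (relCycles₁ (extPair G f s)) -
      finrank (ZMod 2) ↥(relCycles₁ (extPair G f s) ⊓ relBoundaries₁ (extPair G f s')) :=
  finrank_range_homologyMap _ _

end Rank

/-! ### The order of the extended index set and vanishing of multiplicities -/

section Multiplicity

theorem up_le_up {s t : ℝ} : up s ≤ up t ↔ s ≤ t := Sum.Lex.inl_le_inl_iff

theorem up_lt_up {s t : ℝ} : up s < up t ↔ s < t := Sum.Lex.inl_lt_inl_iff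

theorem up_lt_down (s t : ℝ) : up s < down t := Sum.Lex.inl_lt_inr _ _

theorem down_le_down {s t : ℝ} : down s ≤ down t ↔ t ≤ s :=
  Sum.Lex.inr_le_inr_iff.trans OrderDual.toDual_le_toDual

theorem down_lt_down {s t : ℝ} : down s < down t ↔ t < s :=
  Sum.Lex.inr_lt_inr_iff.trans OrderDual.toDual_lt_toDual

theorem eq_up_or_eq_down (s : ExtIndex) : (∃ t, s = up t) ∨ ∃ a, s = down a := by
  rcases h : ofLex s with t | a
  · exact Or.inl ⟨t, by rw [← toLex_ofLex s, h]; rfl⟩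
  · exact Or.inr ⟨OrderDual.ofDual a, by rw [← toLex_ofLex s, h]; rfl⟩

variable {β : (s s' : ExtIndex) → s ≤ s' → ℕ} {b d : ExtIndex}

theorem pointMultiplicity_eq_zero_of_le (h : d ≤ b) : pointMultiplicity β b d = 0 := by
  -- The infimum of an empty family of natural numbers is 0.
  have : IsEmpty (Set.Iio b × Set.Ico b d) :=
    ⟨fun q => absurd (q.2.2.1.trans_lt q.2.2.2) h.not_gt⟩
  exact Nat.iInf_of_empty _

/-- A point has multiplicity `0` if no class is born there. -/
theorem pointMultiplicity_eq_zero_of_birth {s : ExtIndex} (hs : s < b)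
    (h : ∀ s' (h : b ≤ s'), β s s' (hs.le.trans h) = β b s' h) :
    pointMultiplicity β b d = 0 := by
  rcases le_or_gt d b with hdb | hbd
  · exact pointMultiplicity_eq_zero_of_le hdb
  · refine Nat.eq_zero_of_le_zero
      ((ciInf_le' _ (⟨s, hs⟩, ⟨b, le_rfl, hbd⟩)).trans (le_of_eq ?_))
    simp only [h b le_rfl, h d hbd.le, Nat.sub_self]

/-- A point has multiplicity `0` if no class dies there. -/
theorem pointMultiplicity_eq_zero_of_death {s s' : ExtIndex} (hs : s < b) (hb : b ≤ s')
    (hs' : s' < d) (h : ∀ s (h : s ≤ s'), β s s' h = β s d (h.trans hs'.le)) :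
    pointMultiplicity β b d = 0 := by
  refine Nat.eq_zero_of_le_zero
    ((ciInf_le' _ (⟨s, hs⟩, ⟨s', hb, hs'⟩)).trans (le_of_eq ?_))
  simp only [h b hb, h s (hs.le.trans hb)]
  omega

end Multiplicity

/-! ### The diagram of an integer-valued filter function at two points -/

section Diagram

open Module

variable {V : Type*} {G : SimpleGraph V} {f : V → ℝ}

theorem extPair_up (t : ℝ) : extPair G f (up t) = (sublevel G f t, ⊥) := rfl

theorem extPair_down (a : ℝ) : extPair G f (down a) = (⊤, superlevel G f a) := rfl

theorem chains₀_congr {K L : G.Subgraph} (h : K.verts = L.verts) : chains₀ K = chains₀ L := by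
  ext c
  change (∀ v, v ∉ K.verts → c v = 0) ↔ ∀ v, v ∉ L.verts → c v = 0
  rw [h]

theorem chains₁_eq_bot {K : G.Subgraph} (h : ∀ u v, ¬ K.Adj u v) : chains₁ K = ⊥ := by
  refine (Submodule.eq_bot_iff _).2 fun c hc => funext fun e => ?_
  induction e with
  | _ u v => exact hc _ (h u v)

theorem chains₁_bot : chains₁ (⊥ : G.Subgraph) = ⊥ := chains₁_eq_bot fun _ _ h => h

theorem chains₀_bot : chains₀ (⊥ : G.Subgraph) = ⊥ :=
  (Submodule.eq_bot_iff _).2 fun _ hc => funext fun v => hc v fun h => h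

theorem chains₁_inf_chains₁_eq_bot {K L : G.Subgraph} (h : ∀ u v, K.Adj u v → ¬ L.Adj u v) :
    chains₁ K ⊓ chains₁ L = ⊥ := by
  refine (Submodule.eq_bot_iff _).2 fun c hc => funext fun e => ?_
  induction e with
  | _ u v =>
    by_cases hK : K.Adj u v
    · exact hc.2 _ (h u v hK)
    · exact hc.1 _ hK

/-- Vertices enter only at integers, so thresholds between two integers affect at most the edges. -/
theorem verts_sublevel_congr (hf : ∀ v, ∃ n : ℤ, f v = n) {s t : ℝ} (n : ℤ)
    (hs : n ≤ s) (hst : s ≤ t) (ht : t < n + 1) :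
    (sublevel G f s).verts = (sublevel G f t).verts := by
  ext v
  obtain ⟨m, hm⟩ := hf v
  change f v ≤ s ↔ f v ≤ t
  rw [hm]
  refine ⟨fun h => h.trans hst, fun h => ?_⟩
  have h1 : (m : ℝ) < ((n + 1 : ℤ) : ℝ) := by push_cast; linarith
  have h2 : m ≤ n := Int.lt_add_one_iff.1 (by exact_mod_cast h1)
  exact le_trans (by exact_mod_cast h2) hs

theorem verts_superlevel_congr (hf : ∀ v, ∃ n : ℤ, f v = n) {s t : ℝ} (n : ℤ)
    (hs : n - 1 < s) (hst : s ≤ t) (ht : t ≤ n) :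
    (superlevel G f s).verts = (superlevel G f t).verts := by
  ext v
  obtain ⟨m, hm⟩ := hf v
  change s ≤ f v ↔ t ≤ f v
  rw [hm]
  refine ⟨fun h => ?_, fun h => hst.trans h⟩
  have h1 : ((n - 1 : ℤ) : ℝ) < m := by push_cast; linarith
  have h2 : n ≤ m := Int.sub_one_lt_iff.1 (by exact_mod_cast h1)
  exact ht.trans (by exact_mod_cast h2)

/-- Both endpoints have values between 3/2 and 5/2, and 2 is the only integer there. -/
theorem layer_of_ascEdge_descEdge (hf : ∀ v, ∃ n : ℤ, f v = n) {u v : V}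
    (h1 : ascEdge f u v ≤ 5 / 2)
    (h2 : 3 / 2 ≤ descEdge f u v) :
    f u = 2 ∧ f v = 2 ∧ ascEdge f u v = 5 / 2 ∧ descEdge f u v = 3 / 2 := by
  have key : ∀ w, f w ≤ 5 / 2 → 3 / 2 ≤ f w → f w = 2 := by
    intro w h3 h4
    obtain ⟨m, hm⟩ := hf w
    rw [hm] at h3 h4 ⊢
    have h5 : m < 3 := by exact_mod_cast lt_of_le_of_lt h3 (by norm_num : (5 / 2 : ℝ) < 3)
    have h6 : 1 < m := by exact_mod_cast lt_of_lt_of_le (by norm_num : (1 : ℝ) < 3 / 2) h4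
    have : m = 2 := by omega
    exact_mod_cast this
  have hu := key u ((le_ascEdge f u v).trans h1) (h2.trans (descEdge_le f u v))
  have hv := key v ((ascEdge_comm f u v ▸ le_ascEdge f v u).trans h1)
    (h2.trans (descEdge_comm f u v ▸ descEdge_le f v u))
  refine ⟨hu, hv, ?_, ?_⟩ <;> simp [ascEdge, descEdge, hu, hv] <;> norm_num

variable [Fintype V]

theorem relCycles₁_inf_chains₁_eq_bot {P : G.Subgraph × G.Subgraph} {L : G.Subgraph}
    (h : ∀ u v, P.1.Adj u v → ¬ L.Adj u v) : relCycles₁ P ⊓ chains₁ L = ⊥ :=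
  eq_bot_mono (inf_le_inf_right _ inf_le_left) (chains₁_inf_chains₁_eq_bot h)

/-- Among the four ranks that enter the multiplicity, only the one from 5/2 to 3/2 has a nonzero `Z
⊓ B'`, namely the cycles of the layer: an earlier birth or an earlier death threshold excludes every
edge of the layer. The dimensions of `Z` cancel. -/
theorem multiplicity_layerTwo (hf : ∀ v, ∃ n : ℤ, f v = n) :
    pointMultiplicity (extRank₁ G f) (up (5 / 2)) (down (3 / 2)) =
      finrank (ZMod 2) (relCycles₁ (((⊤ : G.Subgraph).induce {v | f v = 2}, ⊥) :
        G.Subgraph × G.Subgraph)) := by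
  have hP : relCycles₁ (extPair G f (up (5 / 2))) ⊓ relBoundaries₁ (extPair G f (down (3 / 2))) =
      relCycles₁ (((⊤ : G.Subgraph).induce {v | f v = 2}, ⊥) : G.Subgraph × G.Subgraph) := by
    have hc : chains₁ (sublevel G f (5 / 2)) ⊓ chains₁ (superlevel G f (3 / 2)) =
        chains₁ ((⊤ : G.Subgraph).induce {v | f v = 2}) := by
      refine le_antisymm (fun c hc e he => ?_) (le_inf ?_ ?_)
      · induction e with
        | _ u v =>
          by_cases h1 : (sublevel G f (5 / 2)).Adj u v
          · refine hc.2 _ fun h2 => he ?_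
            obtain ⟨hu, hv, -⟩ := layer_of_ascEdge_descEdge hf h1.2 h2.2
            exact ⟨hu, hv, h1.1⟩
          · exact hc.1 _ h1
      · refine chains₁_mono ⟨fun v hv => ?_, fun u v h => ⟨h.2.2, ?_⟩⟩
        · change f v = 2 at hv
          change f v ≤ 5 / 2
          rw [hv]; norm_num
        · obtain ⟨hu, hv, -⟩ := h
          change f u = 2 at hu
          change f v = 2 at hv
          simp [ascEdge, hu, hv]; norm_num
      · refine chains₁_mono ⟨fun v hv => ?_, fun u v h => ⟨h.2.2, ?_⟩⟩
        · change f v = 2 at hv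
          change 3 / 2 ≤ f v
          rw [hv]; norm_num
        · obtain ⟨hu, hv, -⟩ := h
          change f u = 2 at hu
          change f v = 2 at hv
          simp [descEdge, hu, hv]; norm_num
    simp only [extPair_up, extPair_down, relCycles₁, relBoundaries₁]
    rw [← hc, inf_right_comm]
  have hbot : ∀ t (_ : t ≤ 5 / 2) a (_ : 3 / 2 ≤ a), t < 5 / 2 ∨ 3 / 2 < a →
      relCycles₁ (extPair G f (up t)) ⊓ relBoundaries₁ (extPair G f (down a)) = ⊥ := by
    intro t ht a ha hta
    refine relCycles₁_inf_chains₁_eq_bot fun u v h1 h2 => ?_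
    have h3 : ascEdge f u v ≤ t := h1.2
    have h4 : a ≤ descEdge f u v := h2.2
    obtain ⟨-, -, h5, h6⟩ := layer_of_ascEdge_descEdge hf (h3.trans ht) (ha.trans h4)
    rcases hta with h | h <;> linarith
  have hbot' : ∀ t t', relCycles₁ (extPair G f (up t)) ⊓ relBoundaries₁ (extPair G f (up t')) =
      ⊥ := fun t t' => by
    rw [extPair_up t', relBoundaries₁, chains₁_bot, inf_bot_eq]
  have : Nonempty (Set.Iio (up (5 / 2)) × Set.Ico (up (5 / 2)) (down (3 / 2))) :=
    ⟨⟨up 0, up_lt_up.2 (by norm_num)⟩, ⟨up (5 / 2), le_rfl, up_lt_down _ _⟩⟩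
  -- The expression is the same for all `q`, so the infimum is its constant value.
  refine (iInf_congr fun q => ?_).trans ciInf_const
  obtain ⟨⟨s, hs⟩, ⟨s', hs'⟩⟩ := q
  rcases eq_up_or_eq_down s with ⟨t, rfl⟩ | ⟨t, rfl⟩
  swap
  · exact absurd (lt_trans (Set.mem_Iio.1 hs) (up_lt_down _ t)) (lt_irrefl _)
  have ht : t < 5 / 2 := up_lt_up.1 hs
  have hle : finrank (ZMod 2) ↥(relCycles₁ (extPair G f (up (5 / 2))) ⊓
      relBoundaries₁ (extPair G f (down (3 / 2)))) ≤
      finrank (ZMod 2) (relCycles₁ (extPair G f (up (5 / 2)))) :=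
    Submodule.finrank_mono inf_le_left
  have h1 : relCycles₁ (extPair G f (up (5 / 2))) ⊓ relBoundaries₁ (extPair G f s') = ⊥ := by
    rcases eq_up_or_eq_down s' with ⟨t', rfl⟩ | ⟨a, rfl⟩
    · exact hbot' _ _
    · have ha := down_lt_down.1 hs'.2
      exact hbot _ le_rfl _ ha.le (Or.inr ha)
  have h2 : relCycles₁ (extPair G f (up t)) ⊓ relBoundaries₁ (extPair G f s') = ⊥ := by
    rcases eq_up_or_eq_down s' with ⟨t', rfl⟩ | ⟨a, rfl⟩
    · exact hbot' _ _
    · exact hbot _ ht.le _ (down_lt_down.1 hs'.2).le (Or.inl ht)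
  rw [← hP]
  simp only [extRank₁_eq]
  rw [h1, h2, hbot t ht.le (3 / 2) le_rfl (Or.inl ht), finrank_bot]
  omega

/-- The multiplicity of `(5/2, 3/2)` is the first Betti number of the layer with value `2`. -/
theorem extPersistenceDiagram_layerTwo (hf : ∀ v, ∃ n : ℤ, f v = n) :
    extPersistenceDiagram G f (5 / 2, 3 / 2) =
      finrank (ZMod 2) (relCycles₁ (((⊤ : G.Subgraph).induce {v | f v = 2}, ⊥) :
        G.Subgraph × G.Subgraph)) := by
  have hlt : up (3 / 2) ≤ up (5 / 2) := up_le_up.2 (by norm_num)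
  have h1 : pointMultiplicity (extRank₀ G f) (up (5 / 2)) (down (3 / 2)) = 0 := by
    refine pointMultiplicity_eq_zero_of_birth (s := up 2) (up_lt_up.2 (by norm_num))
      fun s' h => ?_
    have : relCycles₀ (extPair G f (up 2)) = relCycles₀ (extPair G f (up (5 / 2))) :=
      chains₀_congr (verts_sublevel_congr hf 2 (by norm_num) (by norm_num) (by norm_num))
    rw [extRank₀_eq, extRank₀_eq, this]
  have h2 : pointMultiplicity (extRank₀ G f) (down (5 / 2)) (down (3 / 2)) = 0 := by
    refine pointMultiplicity_eq_zero_of_birth (s := down 3) (down_lt_down.2 (by norm_num))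
      fun s' h => ?_
    rw [extRank₀_eq, extRank₀_eq]
    rfl
  have h3 : pointMultiplicity (extRank₁ G f) (down (5 / 2)) (down (3 / 2)) = 0 := by
    refine pointMultiplicity_eq_zero_of_birth (s := down 3) (down_lt_down.2 (by norm_num))
      fun s' h => ?_
    -- Relative 1-cycles depend on the superlevel complex only through its vertices, which do not
    -- change between 3 and 5/2.
    have : relCycles₁ (extPair G f (down 3)) = relCycles₁ (extPair G f (down (5 / 2))) := by
      simp only [extPair_down, relCycles₁]
      rw [chains₀_congr (verts_superlevel_congr hf 3 (s := 5 / 2) (t := 3) (by norm_num)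
        (by norm_num) (by norm_num))]
    rw [extRank₁_eq, extRank₁_eq, this]
  simp only [extPersistenceDiagram, pointMultiplicity_eq_zero_of_le hlt, h1, h2, h3,
    multiplicity_layerTwo hf, zero_add, add_zero]

/-- If `f ≥ 1` and no two nodes with value `1` are adjacent, then `(1, 3/2)` is not in the
diagram. -/
theorem extPersistenceDiagram_one_eq_zero (hf : ∀ v, ∃ n : ℤ, f v = n)
    (h1 : ∀ v, 1 ≤ f v)
    (h : ∀ u v, G.Adj u v → f u = 1 → f v ≠ 1) :
    extPersistenceDiagram G f (1, 3 / 2) = 0 := by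
  have hlt : down (3 / 2) ≤ down 1 := down_le_down.2 (by norm_num)
  have hsub : sublevel G f 1 = sublevel G f (3 / 2) := by
    have hv := verts_sublevel_congr (G := G) hf (s := 1) (t := 3 / 2) 1 (by norm_num)
      (by norm_num) (by norm_num)
    refine SimpleGraph.Subgraph.ext hv ?_
    funext u v
    refine propext ⟨fun h => ⟨h.1, h.2.trans (by norm_num)⟩, fun hadj => ⟨hadj.1, ?_⟩⟩
    have hu : f u ≤ 1 := hv.ge ((sublevel G f (3 / 2)).edge_vert hadj)
    have hw : f v ≤ 1 := hv.ge ((sublevel G f (3 / 2)).edge_vert hadj.symm)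
    exact absurd (le_antisymm hw (h1 v)) (h u v hadj.1 (le_antisymm hu (h1 u)))
  have hpair : extPair G f (up 1) = extPair G f (up (3 / 2)) := by
    rw [extPair_up, extPair_up, hsub]
  have huu₀ : pointMultiplicity (extRank₀ G f) (up 1) (up (3 / 2)) = 0 := by
    refine pointMultiplicity_eq_zero_of_death (s := up 0) (s' := up 1)
      (up_lt_up.2 (by norm_num)) le_rfl (up_lt_up.2 (by norm_num)) fun s h => ?_
    rw [extRank₀_eq, extRank₀_eq, hpair]
  have huu₁ : pointMultiplicity (extRank₁ G f) (up 1) (up (3 / 2)) = 0 := by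
    refine pointMultiplicity_eq_zero_of_death (s := up 0) (s' := up 1)
      (up_lt_up.2 (by norm_num)) le_rfl (up_lt_up.2 (by norm_num)) fun s h => ?_
    rw [extRank₁_eq, extRank₁_eq, hpair]
  have hud₀ : pointMultiplicity (extRank₀ G f) (up 1) (down (3 / 2)) = 0 := by
    refine pointMultiplicity_eq_zero_of_death (s := up 0) (s' := down 2)
      (up_lt_up.2 (by norm_num)) (up_lt_down _ _).le (down_lt_down.2 (by norm_num))
      fun s h => ?_
    -- Degree 0 classes die in the descending part only when vertices enter, hence only at integers.
    have : relBoundaries₀ (extPair G f (down 2)) = relBoundaries₀ (extPair G f (down (3 / 2))) := by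
      simp only [extPair_down, relBoundaries₀]
      rw [chains₀_congr (verts_superlevel_congr hf 2 (s := 3 / 2) (t := 2) (by norm_num)
        (by norm_num) (by norm_num))]
    rw [extRank₀_eq, extRank₀_eq, this]
  have hud₁ : pointMultiplicity (extRank₁ G f) (up 1) (down (3 / 2)) = 0 := by
    refine pointMultiplicity_eq_zero_of_birth (s := up 0) (up_lt_up.2 (by norm_num))
      fun s' h' => ?_
    have hz : ∀ t ≤ 1, relCycles₁ (extPair G f (up t)) = ⊥ := fun t ht => by
      refine eq_bot_mono inf_le_left (chains₁_eq_bot fun u v hadj => ?_)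
      have hu : f u ≤ 1 := ((sublevel G f t).edge_vert hadj).trans ht
      have hw : f v ≤ 1 := ((sublevel G f t).edge_vert hadj.symm).trans ht
      exact h u v hadj.1 (le_antisymm hu (h1 u)) (le_antisymm hw (h1 v))
    rw [extRank₁_eq, extRank₁_eq, hz 0 (by norm_num), hz 1 le_rfl]
  simp only [extPersistenceDiagram, pointMultiplicity_eq_zero_of_le hlt, huu₀, huu₁, hud₀, hud₁,
    add_zero]

/-- If `f ≥ 1` and two nodes with value `1` are adjacent, then `(1, 3/2)` is in the diagram. -/
theorem extPersistenceDiagram_one_ne_zero (hf : ∀ v, ∃ n : ℤ, f v = n)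
    (h1 : ∀ v, 1 ≤ f v) {u v : V} (huv : G.Adj u v)
    (hu : f u = 1) (hv : f v = 1) :
    extPersistenceDiagram G f (1, 3 / 2) ≠ 0 := by
  classical
  suffices h : 1 ≤ pointMultiplicity (extRank₀ G f) (up 1) (up (3 / 2)) by
    simp only [extPersistenceDiagram]
    omega
  have : Nonempty (Set.Iio (up 1) × Set.Ico (up 1) (up (3 / 2))) :=
    ⟨⟨up 0, up_lt_up.2 (by norm_num)⟩, ⟨up 1, le_rfl, up_lt_up.2 (by norm_num)⟩⟩
  refine le_ciInf fun q => ?_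
  obtain ⟨⟨s, hs⟩, ⟨s', hs'⟩⟩ := q
  rcases eq_up_or_eq_down s with ⟨t, rfl⟩ | ⟨t, rfl⟩
  swap
  · exact absurd (lt_trans (Set.mem_Iio.1 hs) (up_lt_down _ t)) (lt_irrefl _)
  rcases eq_up_or_eq_down s' with ⟨t', rfl⟩ | ⟨t', rfl⟩
  swap
  · exact absurd (lt_trans hs'.2 (up_lt_down _ t')) (lt_irrefl _)
  have ht : t < 1 := up_lt_up.1 hs
  have ht' : t' < 3 / 2 := up_lt_up.1 hs'.2
  have hz : relCycles₀ (extPair G f (up t)) = ⊥ :=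
    (Submodule.eq_bot_iff _).2 fun c hc => funext fun w => hc w fun hw =>
      absurd (h1 w) (not_le.2 (lt_of_le_of_lt hw ht))
  have hb : relBoundaries₀ (extPair G f (up t')) = ⊥ := by
    rw [extPair_up, relBoundaries₀, chains₀_bot, chains₁_eq_bot, Submodule.map_bot, sup_bot_eq]
    intro x y hadj
    have h2 : ascEdge f x y ≤ t' := hadj.2
    have hx := h1 x
    have hy := h1 y
    unfold ascEdge at h2
    split_ifs at h2 with h3
    · linarith
    · have key : ∀ w, f w ≤ t' → f w ≤ 1 := fun w hw =>
        (verts_sublevel_congr (G := G) hf (s := 1) (t := max 1 t') 1 (by norm_num)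
          (le_max_left _ _) (max_lt (by norm_num) (by norm_num; linarith))).ge
          (hw.trans (le_max_right _ _) : f w ≤ max 1 t')
      obtain ⟨hx', hy'⟩ := max_le_iff.1 h2
      exact h3 (le_antisymm ((key x hx').trans hy) ((key y hy').trans hx))
  -- The class `u + v` is born at 1 and is killed by the edge `uv` exactly at 3/2.
  let c : V → ZMod 2 := boundary V (Pi.single s(u, v) 1)
  have hcu : c u = 1 := by
    change ∑ w, (Pi.single s(u, v) 1 : Sym2 V → ZMod 2) s(u, w) = 1
    rw [Finset.sum_eq_single v]
    · simp
    · intro w _ hw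
      rw [Pi.single_eq_of_ne]
      simp [hw, huv.ne]
    · simp
  have hc : ∀ w, w ≠ u → w ≠ v → c w = 0 := by
    intro w hwu hwv
    refine Finset.sum_eq_zero fun x _ => Pi.single_eq_of_ne ?_ _
    simp [hwu, hwv]
  have hmem : c ∈ relCycles₀ (extPair G f (up 1)) ⊓ relBoundaries₀ (extPair G f (up (3 / 2))) := by
    refine ⟨fun w hw => hc w ?_ ?_, Submodule.mem_sup_left (Submodule.mem_map_of_mem fun e he => ?_)⟩
    · rintro rfl
      exact hw hu.le
    · rintro rfl
      exact hw hv.le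
    · refine Pi.single_eq_of_ne ?_ _
      rintro rfl
      refine he ⟨huv, ?_⟩
      simp [ascEdge, hu, hv]
      norm_num
  have hpos : 0 < finrank (ZMod 2) ↥(relCycles₀ (extPair G f (up 1)) ⊓
      relBoundaries₀ (extPair G f (up (3 / 2)))) := by
    refine finrank_pos_iff.2 ((Submodule.nontrivial_iff_ne_bot).2 fun hbot => ?_)
    rw [hbot, Submodule.mem_bot] at hmem
    rw [hmem] at hcu
    exact zero_ne_one hcu
  have hle : finrank (ZMod 2) ↥(relCycles₀ (extPair G f (up 1)) ⊓
      relBoundaries₀ (extPair G f (up (3 / 2)))) ≤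
      finrank (ZMod 2) (relCycles₀ (extPair G f (up 1))) :=
    Submodule.finrank_mono inf_le_left
  simp only [extRank₀_eq]
  rw [hz, hb, inf_bot_eq, bot_inf_eq, bot_inf_eq, finrank_bot]
  omega

end Diagram

/-! ### Cycles of induced subgraphs -/

section Induced

open Module

variable {V : Type*} [Fintype V] {G : SimpleGraph V}

/-- The cycles of the subgraph of `G` induced on `T`. -/
abbrev cyclesOn (G : SimpleGraph V) (T : Set V) : Submodule (ZMod 2) (Sym2 V → ZMod 2) :=
  relCycles₁ (((⊤ : G.Subgraph).induce T, ⊥) : G.Subgraph × G.Subgraph)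

theorem mem_cyclesOn {T : Set V} {z : Sym2 V → ZMod 2} : z ∈ cyclesOn G T ↔
    (∀ u v, ¬ (u ∈ T ∧ v ∈ T ∧ G.Adj u v) → z s(u, v) = 0) ∧ ∀ v, ∑ w, z s(v, w) = 0 := by
  constructor
  · rintro ⟨h1, h2⟩
    exact ⟨fun u v h => h1 s(u, v) h, fun v => h2 v id⟩
  · rintro ⟨h1, h2⟩
    refine ⟨fun e => ?_, fun v _ => h2 v⟩
    induction e with
    | _ u v => exact h1 u v

/-- Cycles on `T` vanish off the pairs in `T`, so restriction to `s` loses nothing and extension by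
zero inverts it. This makes the layer independent of the vicinity containing it. -/
theorem finrank_cyclesOn_induce (s T : Set V) [Fintype s] (h : T ⊆ s) :
    finrank (ZMod 2) (cyclesOn (G.induce s) (Subtype.val ⁻¹' T)) =
      finrank (ZMod 2) (cyclesOn G T) := by
  classical
  let ι : Sym2 s → Sym2 V := Sym2.map Subtype.val
  have hι : Function.Injective ι := Sym2.map.injective Subtype.val_injective
  have hsum : ∀ (z : Sym2 V → ZMod 2), (∀ u v, ¬ (u ∈ T ∧ v ∈ T ∧ G.Adj u v) → z s(u, v) = 0) →
      ∀ v : V, ∑ w, z s(v, w) = ∑ w : s, z s(v, w) := by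
    intro z hz v
    rw [← Finset.sum_subtype (Finset.univ.filter (· ∈ s)) (by simp) fun w => z s(v, w)]
    refine (Finset.sum_subset (Finset.subset_univ _) fun w _ hw => hz v w fun hn => hw ?_).symm
    simpa using h hn.2.1
  let ρ : (Sym2 V → ZMod 2) →ₗ[ZMod 2] (Sym2 s → ZMod 2) := LinearMap.funLeft _ _ ι
  have hρ : ∀ z (u v : s), ρ z s(u, v) = z s(u.1, v.1) := fun z u v => rfl
  have hmem : ∀ z ∈ cyclesOn G T, ρ z ∈ cyclesOn (G.induce s) (Subtype.val ⁻¹' T) := by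
    intro z hz
    obtain ⟨h1, h2⟩ := mem_cyclesOn.1 hz
    refine mem_cyclesOn.2 ⟨fun u v hn => h1 _ _ hn, fun v => ?_⟩
    rw [← h2 v, hsum z h1]
    rfl
  refine (LinearEquiv.finrank_eq (LinearEquiv.ofBijective (ρ.restrict hmem) ⟨?_, ?_⟩)).symm
  · refine (injective_iff_map_eq_zero _).2 fun z hz => Subtype.ext (funext fun e => ?_)
    have hz' : ∀ e, z.1 (ι e) = 0 := fun e => congr_fun (congr_arg Subtype.val hz) e
    induction e with
    | _ u v =>
      by_cases hn : u ∈ T ∧ v ∈ T ∧ G.Adj u v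
      · exact hz' s(⟨u, h hn.1⟩, ⟨v, h hn.2.1⟩)
      · exact (mem_cyclesOn.1 z.2).1 u v hn
  · rintro ⟨y, hy⟩
    obtain ⟨h1, h2⟩ := mem_cyclesOn.1 hy
    let z : Sym2 V → ZMod 2 := Function.extend ι y 0
    have hz : ρ z = y := funext fun e => hι.extend_apply _ _ _
    have hz1 : ∀ u v, ¬ (u ∈ T ∧ v ∈ T ∧ G.Adj u v) → z s(u, v) = 0 := by
      intro u v hn
      by_cases hu : u ∈ s ∧ v ∈ s
      · have := congr_fun hz s(⟨u, hu.1⟩, ⟨v, hu.2⟩)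
        rw [hρ] at this
        rw [this]
        exact h1 _ _ hn
      · refine Function.extend_apply' _ _ _ ?_
        rintro ⟨e, he⟩
        induction e with
        | _ a b =>
          have he' : s(a.1, b.1) = s(u, v) := he
          rcases Sym2.eq_iff.1 he' with ⟨rfl, rfl⟩ | ⟨rfl, rfl⟩
          · exact hu ⟨a.2, b.2⟩
          · exact hu ⟨b.2, a.2⟩
    refine ⟨⟨z, mem_cyclesOn.2 ⟨hz1, fun v => ?_⟩⟩, Subtype.ext hz⟩
    by_cases hv : v ∈ T
    · rw [hsum z hz1, ← h2 ⟨v, h hv⟩]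
      exact Finset.sum_congr rfl fun w _ => by rw [← hz]; rfl
    · exact Finset.sum_eq_zero fun w _ => hz1 v w fun hn => hv hn.1

theorem bettiOne_eq_finrank : bettiOne G = finrank (ZMod 2) (cyclesOn G Set.univ) := by
  have h1 : relCycles₁ ((⊤, ⊥) : G.Subgraph × G.Subgraph) = cyclesOn G Set.univ := by
    rw [cyclesOn, ← SimpleGraph.Subgraph.verts_top, SimpleGraph.Subgraph.induce_self_verts]
  have h2 : (relBoundaries₁ ((⊤, ⊥) : G.Subgraph × G.Subgraph)).submoduleOf
      (relCycles₁ ((⊤, ⊥) : G.Subgraph × G.Subgraph)) = ⊥ := by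
    refine (Submodule.eq_bot_iff _).2 fun z hz => Subtype.ext ?_
    have : z.1 ∈ chains₁ (⊥ : G.Subgraph) := hz
    rwa [chains₁_bot, Submodule.mem_bot] at this
  rw [← h1]
  exact LinearEquiv.finrank_eq (Submodule.quotEquivOfEqBot _ h2)

theorem bettiOne_induce (s : Set V) [Fintype s] :
    bettiOne (G.induce s) = finrank (ZMod 2) (cyclesOn G s) := by
  rw [bettiOne_eq_finrank, ← finrank_cyclesOn_induce s s subset_rfl, Subtype.coe_preimage_self]

/-- If the subgraph induced on `T` is `2`-regular, its cycles correspond to the functions on its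
components, given here by a labelling `κ` with representatives `r`. -/
theorem finrank_cyclesOn_of_two_regular {T : Set V} {ι : Type*} [Fintype ι]
    (hreg : ∀ u ∈ T, ∃ p q, p ≠ q ∧ ∀ w, w ∈ T ∧ G.Adj u w ↔ w = p ∨ w = q)
    (κ : V → ι) (hκ : ∀ u ∈ T, ∀ w ∈ T, G.Adj u w → κ u = κ w)
    (r : ι → V) (hrT : ∀ i, r i ∈ T) (hr : ∀ i, κ (r i) = i)
    (hconn : ∀ F : V → ZMod 2, (∀ u ∈ T, ∀ w ∈ T, G.Adj u w → F u = F w) →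
      ∀ u ∈ T, F u = F (r (κ u))) :
    finrank (ZMod 2) (cyclesOn G T) = Fintype.card ι := by
  classical
  choose! p q hpq hnb using hreg
  have hp : ∀ u ∈ T, p u ∈ T ∧ G.Adj u (p u) := fun u hu => (hnb u hu _).2 (Or.inl rfl)
  have hsum : ∀ z : Sym2 V → ZMod 2, (∀ u v, ¬ (u ∈ T ∧ v ∈ T ∧ G.Adj u v) → z s(u, v) = 0) →
      ∀ u ∈ T, ∑ w, z s(u, w) = z s(u, p u) + z s(u, q u) := by
    intro z hz u hu
    rw [← Finset.sum_pair (hpq u hu) (f := fun w => z s(u, w))]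
    refine (Finset.sum_subset (Finset.subset_univ _) fun w _ hw => hz u w fun hn => hw ?_).symm
    simpa using (hnb u hu w).1 ⟨hn.2.1, hn.2.2⟩
  -- Modulo 2, a vanishing boundary at a vertex of degree two says that its two edges have equal
  -- coefficients; a cycle is therefore constant on each component.
  have hval : ∀ z ∈ cyclesOn G T, ∀ u ∈ T, ∀ w ∈ T, G.Adj u w → z s(u, w) = z s(u, p u) := by
    intro z hz u hu w hw huw
    obtain ⟨h1, h2⟩ := mem_cyclesOn.1 hz
    rcases (hnb u hu w).1 ⟨hw, huw⟩ with rfl | rfl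
    · rfl
    · have := h2 u
      rw [hsum z h1 u hu] at this
      exact (CharTwo.add_eq_zero.1 this).symm
  let Φ : cyclesOn G T →ₗ[ZMod 2] (ι → ZMod 2) :=
    { toFun := fun z i => z.1 s(r i, p (r i))
      map_add' := fun _ _ => rfl
      map_smul' := fun _ _ => rfl }
  have hΦ : Function.Bijective Φ := by
    constructor
    · refine (injective_iff_map_eq_zero _).2 fun z hz => Subtype.ext (funext fun e => ?_)
      induction e with
      | _ u v =>
        by_cases hn : u ∈ T ∧ v ∈ T ∧ G.Adj u v
        · obtain ⟨hu, hv, huv⟩ := hn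
          change z.1 s(u, v) = 0
          rw [hval z.1 z.2 u hu v hv huv, hconn (fun u => z.1 s(u, p u)) ?_ u hu]
          · exact congr_fun hz (κ u)
          · intro a ha b hb hab
            rw [← hval z.1 z.2 a ha b hb hab, ← hval z.1 z.2 b hb a ha hab.symm, Sym2.eq_swap]
        · exact (mem_cyclesOn.1 z.2).1 u v hn
    · intro c
      -- The endpoint picked by `Quot.out` is immaterial, as both ends of an edge have the same
      -- label.
      let z : Sym2 V → ZMod 2 := fun e =>
        if e ∈ ((⊤ : G.Subgraph).induce T).edgeSet then c (κ (Quot.out e).1) else 0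
      have hz : ∀ u ∈ T, ∀ v ∈ T, G.Adj u v → z s(u, v) = c (κ u) := by
        intro u hu v hv huv
        have hmem : s(u, v) ∈ ((⊤ : G.Subgraph).induce T).edgeSet := ⟨hu, hv, huv⟩
        simp only [z, if_pos hmem]
        have h1 : (Quot.out s(u, v)).1 ∈ s(u, v) := Sym2.out_fst_mem _
        rcases Sym2.mem_iff.1 h1 with h2 | h2
        · rw [h2]
        · rw [h2, hκ u hu v hv huv]
      have hz0 : ∀ u v, ¬ (u ∈ T ∧ v ∈ T ∧ G.Adj u v) → z s(u, v) = 0 :=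
        fun u v hn => if_neg hn
      refine ⟨⟨z, mem_cyclesOn.2 ⟨hz0, fun u => ?_⟩⟩, funext fun i => ?_⟩
      · by_cases hu : u ∈ T
        · have hq : q u ∈ T ∧ G.Adj u (q u) := (hnb u hu _).2 (Or.inr rfl)
          rw [hsum z hz0 u hu, hz u hu _ (hp u hu).1 (hp u hu).2, hz u hu _ hq.1 hq.2,
            CharTwo.add_self_eq_zero]
        · exact Finset.sum_eq_zero fun w _ => hz0 u w fun hn => hu hn.1
      · have := hz _ (hrT i) _ (hp _ (hrT i)).1 (hp _ (hrT i)).2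
        rw [hr] at this
        exact this
  rw [LinearEquiv.finrank_eq (LinearEquiv.ofBijective Φ hΦ), finrank_fintype_fun_eq_card]

end Induced

/-! ### The distance filter function of a pair -/

section PairFilter

open Module

variable {V : Type*} {G : SimpleGraph V} {x y : V}

/-- The formula also gives the value 2 to the distance labels (0, 3) and (3, 0), which adjacency of
the pair excludes later. -/
theorem pairFilter_eq_natCast (u : V) : ∃ n : ℕ, pairFilter G x y u = 1 + n ∧
    (n = 0 → G.dist u x = 0 ∨ G.dist u y = 0) ∧
    (n = 1 ↔ (G.dist u x = 1 ∧ G.dist u y = 1) ∨ (G.dist u x = 0 ∧ G.dist u y = 3) ∨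
      (G.dist u x = 3 ∧ G.dist u y = 0)) := by
  unfold pairFilter
  generalize G.dist u x = a
  generalize G.dist u y = b
  rcases Nat.eq_zero_or_pos ((a + b) / 2) with h | h
  · refine ⟨min a b, by simp [h], ?_, ?_⟩ <;> omega
  · obtain ⟨m, hm⟩ : ∃ m, (a + b) / 2 = m + 1 := ⟨_, (Nat.succ_pred_eq_of_pos h).symm⟩
    refine ⟨min a b + (m + 1) * (m + (a + b) % 2), ?_, ?_, ?_⟩
    · simp only [hm]
      push_cast
      ring
    · omega
    · rcases Nat.eq_zero_or_pos m with rfl | hm0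
      · omega
      · constructor
        · intro h1
          have : 2 * 1 ≤ (m + 1) * (m + (a + b) % 2) := Nat.mul_le_mul (by omega) (by omega)
          omega
        · omega

theorem one_le_pairFilter (u : V) : 1 ≤ pairFilter G x y u := by
  obtain ⟨n, hn, -⟩ := pairFilter_eq_natCast (G := G) (x := x) (y := y) u
  rw [hn]
  simp

theorem exists_int_pairFilter (u : V) : ∃ n : ℤ, pairFilter G x y u = n := by
  obtain ⟨n, hn, -⟩ := pairFilter_eq_natCast (G := G) (x := x) (y := y) u
  exact ⟨1 + n, by rw [hn]; push_cast; rfl⟩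

theorem layerTwo_eq_commonNeighbors (h : G.Adj x y) :
    layerTwo G x y = G.commonNeighbors x y := by
  ext u
  obtain ⟨n, hn, -, hn1⟩ := pairFilter_eq_natCast (G := G) (x := x) (y := y) u
  have h1 : u ∈ layerTwo G x y ↔ n = 1 := by
    change pairFilter G x y u = 2 ↔ n = 1
    rw [hn]
    constructor
    · intro h
      exact_mod_cast (by linarith : (n : ℝ) = 1)
    · rintro rfl
      norm_num
  -- `dist` is 0 for unreachable vertices too; but then `u` cannot reach the neighbour `b` either,
  -- whose distance is again 0.
  have hzero : ∀ a b : V, G.Adj a b → G.dist u a = 0 → G.dist u b ≠ 3 := by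
    intro a b hab h0 h3
    rcases SimpleGraph.dist_eq_zero_iff_eq_or_not_reachable.1 h0 with rfl | hr
    · rw [SimpleGraph.dist_eq_one_iff_adj.2 hab] at h3
      omega
    · rw [SimpleGraph.dist_eq_zero_of_not_reachable fun hr' => hr (hr'.trans hab.symm.reachable)]
        at h3
      omega
  rw [h1, hn1, SimpleGraph.mem_commonNeighbors, SimpleGraph.dist_eq_one_iff_adj,
    SimpleGraph.dist_eq_one_iff_adj, G.adj_comm u x, G.adj_comm u y]
  constructor
  · rintro (h | ⟨h0, h3⟩ | ⟨h3, h0⟩)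
    · exact h
    · exact absurd h3 (hzero x y h h0)
    · exact absurd h3 (hzero y x h.symm h0)
  · exact Or.inl

variable [Fintype V]

theorem layerBetti_eq (h : G.Adj x y) :
    layerBetti G x y = finrank (ZMod 2) (cyclesOn G (G.commonNeighbors x y)) := by
  classical
  rw [← layerTwo_eq_commonNeighbors h]
  unfold layerBetti
  exact bettiOne_induce _

theorem pairDiagram_layerTwo (h : G.Adj x y) {k : ℕ} (hk : 1 ≤ k) :
    pairDiagram G k x y (5 / 2, 3 / 2) =
      finrank (ZMod 2) (cyclesOn G (G.commonNeighbors x y)) := by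
  classical
  have hsub : G.commonNeighbors x y ⊆ vicinity G k x y := by
    intro u hu
    have hk' : (1 : ℕ∞) ≤ k := by exact_mod_cast hk
    exact ⟨(SimpleGraph.edist_eq_one_iff_adj.2 hu.1.symm).trans_le hk',
      (SimpleGraph.edist_eq_one_iff_adj.2 hu.2.symm).trans_le hk'⟩
  rw [← layerTwo_eq_commonNeighbors h] at hsub ⊢
  have hf : ∀ u : vicinity G k x y, ∃ n : ℤ, pairFilter G x y u = n :=
    fun u => exists_int_pairFilter u.1
  unfold pairDiagram
  have hlayer : {u : vicinity G k x y | pairFilter G x y u = 2} =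
    Subtype.val ⁻¹' layerTwo G x y := rfl
  rw [extPersistenceDiagram_layerTwo hf, hlayer]
  exact finrank_cyclesOn_induce _ _ hsub

/-- Inside the vicinity only `x` and `y` can have value 1, so an edge between vertices of value 1 is
the edge `xy`. -/
theorem pairDiagram_one_ne_zero_iff {k : ℕ} (hk : 1 ≤ k) :
    pairDiagram G k x y (1, 3 / 2) ≠ 0 ↔ G.Adj x y := by
  classical
  have hk' : (1 : ℕ∞) ≤ k := by exact_mod_cast hk
  refine ⟨fun hne => ?_, fun h => ?_⟩
  · by_contra hadj
    refine hne (extPersistenceDiagram_one_eq_zero (fun u => exists_int_pairFilter u.1)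
      (fun u => one_le_pairFilter u.1) ?_)
    have key : ∀ u : vicinity G k x y, pairFilter G x y u = 1 → u.1 = x ∨ u.1 = y := by
      rintro ⟨u, hu⟩ h1
      obtain ⟨n, hn, hn0, -⟩ := pairFilter_eq_natCast (G := G) (x := x) (y := y) u
      have hn' : (n : ℝ) = 0 := by
        rw [hn] at h1
        linarith
      -- The finite `edist` bound of the vicinity rules out the default distance 0.
      have hx : G.Reachable u x := SimpleGraph.reachable_of_edist_ne_top
        (ne_top_of_le_ne_top (ENat.natCast_ne_top k) hu.1)
      have hy : G.Reachable u y := SimpleGraph.reachable_of_edist_ne_top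
        (ne_top_of_le_ne_top (ENat.natCast_ne_top k) hu.2)
      exact (hn0 (by exact_mod_cast hn')).imp hx.dist_eq_zero_iff.1 hy.dist_eq_zero_iff.1
    intro u v huv hu hv
    have huv' : G.Adj u.1 v.1 := huv
    rcases key u hu with h1 | h1 <;> rcases key v hv with h2 | h2 <;> rw [h1, h2] at huv'
    · exact huv'.ne rfl
    · exact hadj huv'
    · exact hadj huv'.symm
    · exact huv'.ne rfl
  · have hx : x ∈ vicinity G k x y := ⟨by simp [SimpleGraph.edist_self],
      (SimpleGraph.edist_eq_one_iff_adj.2 h).trans_le hk'⟩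
    have hy : y ∈ vicinity G k x y := ⟨(SimpleGraph.edist_eq_one_iff_adj.2 h.symm).trans_le hk',
      by simp [SimpleGraph.edist_self]⟩
    have h1 := SimpleGraph.dist_eq_one_iff_adj.2 h
    have h2 := SimpleGraph.dist_eq_one_iff_adj.2 h.symm
    refine extPersistenceDiagram_one_ne_zero (fun u => exists_int_pairFilter u.1)
      (fun u => one_le_pairFilter u.1) (u := ⟨x, hx⟩) (v := ⟨y, hy⟩) h ?_ ?_
    · simp [pairFilter, h1]
    · simp [pairFilter, h2]

end PairFilter

/-! ### Common neighbours in the CFI graphs -/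

section CommonNeighbours

open Module

variable {ℓ : ℕ} {a b c d e : Fin 5}

theorem sum_eq_sum_of_nodup {l : List (Fin 5)} (hl : l.Nodup) (hlen : l.length = 5)
    (F : Fin 5 → ZMod 2) : ∑ t, F t = (l.map F).sum := by
  have : l.toFinset = Finset.univ := by
    rw [← Finset.card_eq_iff_eq_univ, List.toFinset_card_of_nodup hl, hlen, Fintype.card_fin]
  rw [← this, List.sum_toFinset F hl]

theorem mem_of_nodup {l : List (Fin 5)} (hl : l.Nodup) (hlen : l.length = 5) (t : Fin 5) :
    t ∈ l := by
  have : l.toFinset = Finset.univ := by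
    rw [← Finset.card_eq_iff_eq_univ, List.toFinset_card_of_nodup hl, hlen, Fintype.card_fin]
  rw [← List.mem_toFinset, this]
  exact Finset.mem_univ t

theorem exists_nodup_of_three : ∀ a b c : Fin 5, a ≠ b → a ≠ c → b ≠ c →
    ∃ d e, [a, b, c, d, e].Nodup := by
  decide

theorem node_eq_of_three_bits (h : [a, b, c, d, e].Nodup) {w w' : CFINode ℓ} (hw : fibre w = d)
    (hw' : fibre w' = d) (ha : bit w a = bit w' a) (hb : bit w b = bit w' b)
    (hc : bit w c = bit w' c) : w = w' := by
  have h1 := sum_bit w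
  have h2 := sum_bit w'
  have h3 := bit_self w
  have h4 := bit_self w'
  rw [sum_eq_sum_of_nodup h rfl] at h1 h2
  rw [hw] at h1 h3
  rw [hw'] at h2 h4
  simp only [List.map_cons, List.map_nil, List.sum_cons, List.sum_nil] at h1 h2
  have he : bit w e = bit w' e := by
    linear_combination h1 - h2 - ha - hb - hc - h3 + h4
  refine node_ext (hw.trans hw'.symm) fun t => ?_
  have ht := mem_of_nodup h rfl t
  simp only [List.mem_cons, List.not_mem_nil, or_false] at ht
  rcases ht with rfl | rfl | rfl | rfl | rfl
  exacts [ha, hb, hc, h3.trans h4.symm, he]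

theorem exists_node_of_three_bits (h : [a, b, c, d, e].Nodup) (α β γ : ZMod 2) :
    ∃ w : CFINode ℓ, fibre w = d ∧ bit w a = α ∧ bit w b = β ∧ bit w c = γ := by
  have h' := h
  simp only [List.nodup_cons, List.mem_cons, List.not_mem_nil, or_false, not_or,
    not_false_eq_true, List.nodup_nil, and_true] at h'
  obtain ⟨⟨hab, hac, had, hae⟩, ⟨hbc, hbd, hbe⟩, ⟨hcd, hce⟩, hde⟩ := h'
  let v : Fin 5 → ZMod 2 := fun t => if t = a then α else if t = b then β else
    if t = c then γ else if t = e then fibreParity ℓ d - α - β - γ else 0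
  have va : v a = α := by simp [v]
  have vb : v b = β := by simp [v, Ne.symm hab]
  have vc : v c = γ := by simp [v, Ne.symm hac, Ne.symm hbc]
  have vd : v d = 0 := by simp [v, Ne.symm had, Ne.symm hbd, Ne.symm hcd, hde]
  have ve : v e = fibreParity ℓ d - α - β - γ := by
    simp [v, Ne.symm hae, Ne.symm hbe, Ne.symm hce]
  obtain ⟨w, hw, hbit⟩ := exists_node (ℓ := ℓ) d v vd (by
    rw [sum_eq_sum_of_nodup h rfl]
    simp only [List.map_cons, List.map_nil, List.sum_cons, List.sum_nil, va, vb, vc, vd, ve]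
    ring)
  exact ⟨w, hw, by rw [hbit, va], by rw [hbit, vb], by rw [hbit, vc]⟩

/-- Three nodes in different fibres have exactly one common neighbour in each of the two other
fibres. -/
theorem exists_common_neighbour {x y u : CFINode ℓ}
    (h : [fibre x, fibre y, fibre u, d, e].Nodup) :
    ∃ w : CFINode ℓ, ∀ w', fibre w' = d ∧ (cfiGraph ℓ).Adj x w' ∧ (cfiGraph ℓ).Adj y w' ∧
      (cfiGraph ℓ).Adj u w' ↔ w' = w := by
  obtain ⟨w, hw, hx, hy, hu⟩ := exists_node_of_three_bits (ℓ := ℓ) h (bit x d) (bit y d) (bit u d)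
  have h' := h
  simp only [List.nodup_cons, List.mem_cons, List.not_mem_nil, or_false, not_or,
    not_false_eq_true, List.nodup_nil, and_true] at h'
  obtain ⟨⟨-, -, hxd, -⟩, ⟨-, hyd, -⟩, ⟨hud, -⟩, -⟩ := h'
  refine ⟨w, fun w' => ⟨?_, ?_⟩⟩
  · rintro ⟨hw', h1, h2, h3⟩
    rw [cfiGraph_adj_iff, hw'] at h1 h2 h3
    exact node_eq_of_three_bits h hw' hw (by rw [hx, h1.2]) (by rw [hy, h2.2]) (by rw [hu, h3.2])
  · rintro rfl
    simp only [cfiGraph_adj_iff, hw]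
    exact ⟨trivial, ⟨Ne.symm hxd, hx.symm⟩, ⟨Ne.symm hyd, hy.symm⟩, ⟨Ne.symm hud, hu.symm⟩⟩

theorem fibre_ne_of_adj {x y : CFINode ℓ} (h : (cfiGraph ℓ).Adj x y) : fibre x ≠ fibre y :=
  Ne.symm ((cfiGraph_adj_iff x y).1 h).1

/-- With `u` the three fibres of `x`, `y`, `u` are used up, and each of the two others contributes
exactly one common neighbour of all three. -/
theorem commonNeighbors_two_regular {x y : CFINode ℓ} (hxy : (cfiGraph ℓ).Adj x y) :
    ∀ u ∈ (cfiGraph ℓ).commonNeighbors x y, ∃ p q, p ≠ q ∧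
      ∀ w, w ∈ (cfiGraph ℓ).commonNeighbors x y ∧ (cfiGraph ℓ).Adj u w ↔ w = p ∨ w = q := by
  rintro u ⟨hxu, hyu⟩
  obtain ⟨d, e, hd⟩ := exists_nodup_of_three _ _ _ (fibre_ne_of_adj hxy) (fibre_ne_of_adj hxu)
    (fibre_ne_of_adj hyu)
  have he : [fibre x, fibre y, fibre u, e, d].Nodup :=
    (((List.Perm.swap d e []).cons _).cons _ |>.cons _).nodup_iff.2 hd
  obtain ⟨p, hp⟩ := exists_common_neighbour hd
  obtain ⟨q, hq⟩ := exists_common_neighbour he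
  refine ⟨p, q, ?_, fun w => ⟨?_, ?_⟩⟩
  · rintro rfl
    have h1 := ((hp p).2 rfl).1
    have h2 := ((hq p).2 rfl).1
    rw [h1] at h2
    subst h2
    simp at hd
  · rintro ⟨⟨hxw, hyw⟩, huw⟩
    have ht := mem_of_nodup hd rfl (fibre w)
    simp only [List.mem_cons, List.not_mem_nil, or_false] at ht
    rcases ht with h | h | h | h | h
    · exact absurd h.symm (fibre_ne_of_adj hxw)
    · exact absurd h.symm (fibre_ne_of_adj hyw)
    · exact absurd h.symm (fibre_ne_of_adj huw)
    · exact Or.inl ((hp w).1 ⟨h, hxw, hyw, huw⟩)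
    · exact Or.inr ((hq w).1 ⟨h, hxw, hyw, huw⟩)
  · rintro (h | h)
    · obtain ⟨-, h1, h2, h3⟩ := (hp w).2 h
      exact ⟨⟨h1, h2⟩, h3⟩
    · obtain ⟨-, h1, h2, h3⟩ := (hq w).2 h
      exact ⟨⟨h1, h2⟩, h3⟩

/-- The twisted graph has no clique with five nodes. -/
theorem not_five_clique {x y u v w : CFINode 1} (hxy : (cfiGraph 1).Adj x y)
    (hxu : (cfiGraph 1).Adj x u) (hxv : (cfiGraph 1).Adj x v) (hxw : (cfiGraph 1).Adj x w)
    (hyu : (cfiGraph 1).Adj y u) (hyv : (cfiGraph 1).Adj y v) (hyw : (cfiGraph 1).Adj y w)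
    (huv : (cfiGraph 1).Adj u v) (huw : (cfiGraph 1).Adj u w) (hvw : (cfiGraph 1).Adj v w) :
    False := by
  have hl : [fibre x, fibre y, fibre u, fibre v, fibre w].Nodup := by
    simp [fibre_ne_of_adj hxy, fibre_ne_of_adj hxu, fibre_ne_of_adj hxv, fibre_ne_of_adj hxw,
      fibre_ne_of_adj hyu, fibre_ne_of_adj hyv, fibre_ne_of_adj hyw, fibre_ne_of_adj huv,
      fibre_ne_of_adj huw, fibre_ne_of_adj hvw]
  have htot : ∑ t, fibreParity 1 t = 1 := by decide
  have sx := sum_bit x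
  have sy := sum_bit y
  have su := sum_bit u
  have sv := sum_bit v
  have sw := sum_bit w
  rw [sum_eq_sum_of_nodup hl rfl] at htot sx sy su sv sw
  simp only [List.map_cons, List.map_nil, List.sum_cons, List.sum_nil, bit_self] at *
  rw [cfiGraph_adj_iff] at *
  -- In the sum of the five parities each adjacency pairs two equal bits, so everything is twice a
  -- sum of ten bits.
  have h2 : (2 : ZMod 2) = 0 := rfl
  refine zero_ne_one (α := ZMod 2) ?_
  linear_combination htot + sx + sy + su + sv + sw + hxy.2 + hxu.2 + hxv.2 + hxw.2 + hyu.2 +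
    hyv.2 + hyw.2 + huv.2 + huw.2 + hvw.2 -
    (bit x (fibre y) + bit x (fibre u) + bit x (fibre v) + bit x (fibre w) + bit y (fibre u) +
      bit y (fibre v) + bit y (fibre w) + bit u (fibre v) + bit u (fibre w) +
      bit v (fibre w)) * h2

/-- Going once round the three remaining fibres from `v` must end at the other node of the fibre of
`v`, since closing up would give a 5-clique. Connectedness is phrased by functions that are constant
along edges. -/
theorem commonNeighbors_connected {x y : CFINode 1} (hxy : (cfiGraph 1).Adj x y)
    (F : CFINode 1 → ZMod 2)
    (hF : ∀ u ∈ (cfiGraph 1).commonNeighbors x y, ∀ w ∈ (cfiGraph 1).commonNeighbors x y,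
      (cfiGraph 1).Adj u w → F u = F w)
    (u : CFINode 1) (hu : u ∈ (cfiGraph 1).commonNeighbors x y)
    (v : CFINode 1) (hv : v ∈ (cfiGraph 1).commonNeighbors x y) : F u = F v := by
  have bits : ∀ {w w'}, w ∈ (cfiGraph 1).commonNeighbors x y →
      w' ∈ (cfiGraph 1).commonNeighbors x y → fibre w = fibre w' →
      bit w (fibre x) = bit w' (fibre x) ∧ bit w (fibre y) = bit w' (fibre y) := by
    intro w w' hw hw' h
    have h1 := ((cfiGraph_adj_iff _ _).1 hw.1).2
    have h2 := ((cfiGraph_adj_iff _ _).1 hw.2).2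
    rw [← h1, ← h2, h, ((cfiGraph_adj_iff _ _).1 hw'.1).2, ((cfiGraph_adj_iff _ _).1 hw'.2).2]
    exact ⟨rfl, rfl⟩
  have same : ∀ u ∈ (cfiGraph 1).commonNeighbors x y, ∀ v ∈ (cfiGraph 1).commonNeighbors x y,
      fibre u = fibre v → F u = F v := by
    intro u hu v hv huv
    obtain ⟨d, e, hd⟩ := exists_nodup_of_three _ _ _ (fibre_ne_of_adj hxy)
      (fibre_ne_of_adj hv.1) (fibre_ne_of_adj hv.2)
    have hd' : [fibre x, fibre y, d, fibre v, e].Nodup :=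
      ((List.Perm.swap _ _ [e]).cons _ |>.cons _).nodup_iff.2 hd
    have unique : ∀ u' ∈ (cfiGraph 1).commonNeighbors x y, fibre u' = fibre v →
        bit u d = bit u' d → u = u' := fun u' hu' hf hb =>
      node_eq_of_three_bits hd' huv hf (bits hu hu' (huv.trans hf.symm)).1
        (bits hu hu' (huv.trans hf.symm)).2 hb
    by_cases hb : bit u d = bit v d
    · rw [unique v hv rfl hb]
    obtain ⟨p, hp⟩ := exists_common_neighbour hd
    obtain ⟨hpd, hxp, hyp, hvp⟩ := (hp p).2 rfl
    have hq' : [fibre x, fibre y, fibre p, e, fibre v].Nodup := by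
      rw [hpd]
      exact ((List.perm_append_comm (l₁ := [fibre v]) (l₂ := [d, e])).cons _ |>.cons _
        |>.nodup_iff).1 hd
    obtain ⟨q, hq⟩ := exists_common_neighbour hq'
    obtain ⟨hqe, hxq, hyq, hpq⟩ := (hq q).2 rfl
    have hr' : [fibre x, fibre y, fibre q, fibre v, d].Nodup := by
      rw [hqe]
      exact ((List.perm_append_comm (l₁ := [d]) (l₂ := [e, fibre v])).cons _ |>.cons _
        |>.nodup_iff).1 (hpd ▸ hq')
    obtain ⟨r, hr⟩ := exists_common_neighbour hr'
    obtain ⟨hrv, hxr, hyr, hqr⟩ := (hr r).2 rfl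
    have hne : bit r d ≠ bit v d := fun heq => by
      have hpr : (cfiGraph 1).Adj p r := by
        rw [cfiGraph_adj_iff, hrv, hpd, heq]
        have := (cfiGraph_adj_iff _ _).1 hvp
        rw [hpd] at this
        exact ⟨this.1.symm, this.2.symm⟩
      exact not_five_clique hxy hxp hxq hxr hyp hyq hyr hpq hpr hqr
    -- In this fibre a common neighbour is determined by its bit towards `d`; `u` and `r` both
    -- differ from `v` there, so they coincide.
    have two : ∀ α β γ : ZMod 2, α ≠ γ → β ≠ γ → α = β := by decide
    rw [unique r ⟨hxr, hyr⟩ hrv (two _ _ _ hb hne), ← hF q ⟨hxq, hyq⟩ r ⟨hxr, hyr⟩ hqr,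
      ← hF p ⟨hxp, hyp⟩ q ⟨hxq, hyq⟩ hpq, ← hF v hv p ⟨hxp, hyp⟩ hvp]
  by_cases huv : fibre u = fibre v
  · exact same u hu v hv huv
  · obtain ⟨d, e, hd⟩ := exists_nodup_of_three _ _ _ (fibre_ne_of_adj hxy)
      (fibre_ne_of_adj hv.1) (fibre_ne_of_adj hv.2)
    have key : ∀ d e, [fibre x, fibre y, fibre v, d, e].Nodup → fibre u = d → F u = F v := by
      intro d e hd hud
      obtain ⟨p, hp⟩ := exists_common_neighbour hd
      obtain ⟨hpd, hxp, hyp, hvp⟩ := (hp p).2 rfl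
      rw [hF v hv p ⟨hxp, hyp⟩ hvp]
      exact same u hu p ⟨hxp, hyp⟩ (hud.trans hpd.symm)
    have ht := mem_of_nodup hd rfl (fibre u)
    simp only [List.mem_cons, List.not_mem_nil, or_false] at ht
    rcases ht with h | h | h | h | h
    · exact absurd h.symm (fibre_ne_of_adj hu.1)
    · exact absurd h.symm (fibre_ne_of_adj hu.2)
    · exact absurd h huv
    · exact key d e hd h
    · exact key e d ((((List.Perm.swap d e []).cons _).cons _ |>.cons _).nodup_iff.2 hd) h

theorem finrank_cyclesOn_twisted {x y : CFINode 1} (hxy : (cfiGraph 1).Adj x y) :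
    finrank (ZMod 2) (cyclesOn (cfiGraph 1) ((cfiGraph 1).commonNeighbors x y)) = 1 := by
  obtain ⟨c, hc⟩ : ∃ c, c ≠ fibre x ∧ c ≠ fibre y := by
    generalize fibre x = a
    generalize fibre y = b
    revert a b
    decide
  obtain ⟨d, e, hd⟩ := exists_nodup_of_three _ _ _ (fibre_ne_of_adj hxy) hc.1.symm hc.2.symm
  -- The bit towards `c` is free; 0 is an arbitrary choice.
  obtain ⟨w, hw, hwx, hwy, -⟩ := exists_node_of_three_bits (ℓ := 1) hd (bit x d) (bit y d) 0
  have hmem : w ∈ (cfiGraph 1).commonNeighbors x y := by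
    simp only [List.nodup_cons, List.mem_cons, List.not_mem_nil, or_false, not_or] at hd
    rw [SimpleGraph.mem_commonNeighbors, cfiGraph_adj_iff, cfiGraph_adj_iff, hw]
    exact ⟨⟨Ne.symm hd.1.2.2.1, hwx.symm⟩, ⟨Ne.symm hd.2.1.2.1, hwy.symm⟩⟩
  exact finrank_cyclesOn_of_two_regular (ι := Unit) (commonNeighbors_two_regular hxy) (fun _ => ())
    (fun _ _ _ _ _ => rfl) (fun _ => w) (fun _ => hmem) (fun _ => rfl)
    fun F hF u hu => commonNeighbors_connected hxy F hF u hu w hmem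

end CommonNeighbours

/-! ### The targets -/

section Targets

open Module

instance (ℓ : ℕ) : DecidableRel (cfiGraph ℓ).Adj := fun x y =>
  inferInstanceAs (Decidable (∃ m : Fin 4,
    y.1.1.val % 5 = (x.1.1.val + (m.val + 1)) % 5 ∧ x.1.2 m = y.1.2 m.rev))

theorem adj_cfiTargets (ℓ : ℕ) (h : ℓ ≤ 3) :
    (cfiGraph ℓ).Adj (cfiTarget₁ ℓ h) (cfiTarget₂ ℓ h) :=
  ⟨0, rfl, rfl⟩

/-- Representatives of the two components of the common neighbours of the targets. -/
def untwistedRep (i : Bool) : CFINode 0 :=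
  -- At base vertex 2 the coordinates 2 and 3 point to the targets' fibres and must be 0. The first
  -- two are then equal by parity.
  ⟨(2, fun m => i && decide (m.val < 2)), by cases i <;> decide⟩

/-- Whether some coordinate of a node is `1`. -/
def hasOne (u : CFINode 0) : Bool := decide (∃ m, u.1.2 m = true)

theorem finrank_cyclesOn_untwisted :
    finrank (ZMod 2) (cyclesOn (cfiGraph 0) ((cfiGraph 0).commonNeighbors
      (cfiTarget₁ 0 (by decide)) (cfiTarget₂ 0 (by decide)))) = 2 := by
  refine finrank_cyclesOn_of_two_regular (ι := Bool)
    (commonNeighbors_two_regular (adj_cfiTargets 0 _)) hasOne ?_ untwistedRep ?_ ?_ ?_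
  · simp only [SimpleGraph.mem_commonNeighbors]
    decide +kernel
  · simp only [SimpleGraph.mem_commonNeighbors]
    decide +kernel
  · decide +kernel
  · intro F hF u hu
    have h1 : ∀ i, untwistedRep i ∈ (cfiGraph 0).commonNeighbors
        (cfiTarget₁ 0 (by decide)) (cfiTarget₂ 0 (by decide)) := by
      simp only [SimpleGraph.mem_commonNeighbors]
      decide +kernel
    -- The components are triangles, so each node is the representative or adjacent to it.
    have h2 : ∀ u, (cfiGraph 0).Adj (cfiTarget₁ 0 (by decide)) u →
        (cfiGraph 0).Adj (cfiTarget₂ 0 (by decide)) u →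
        u.1 = (untwistedRep (hasOne u)).1 ∨ (cfiGraph 0).Adj u (untwistedRep (hasOne u)) := by
      decide +kernel
    rcases h2 u hu.1 hu.2 with h | h
    · rw [← Subtype.ext h]
    · exact hF u hu _ (h1 _) h

end Targets

theorem theorem2 :
    Fintype.card (CFINode 0) = 40 ∧ Fintype.card (CFINode 1) = 40 ∧
    ¬ WLDistinguishes 4 (cfiGraph 0) (cfiGraph 1) ∧
    (∀ k : ℕ, 1 ≤ k →
      DiagramsDistinguish k (cfiGraph 0) (cfiGraph 1) ∧
      pairDiagram (cfiGraph 0) k (cfiTarget₁ 0 (by decide)) (cfiTarget₂ 0 (by decide)) ≠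
        pairDiagram (cfiGraph 1) k (cfiTarget₁ 1 (by decide)) (cfiTarget₂ 1 (by decide))) ∧
    layerTwo (cfiGraph 0) (cfiTarget₁ 0 (by decide)) (cfiTarget₂ 0 (by decide)) =
      (cfiGraph 0).commonNeighbors (cfiTarget₁ 0 (by decide)) (cfiTarget₂ 0 (by decide)) ∧
    layerTwo (cfiGraph 1) (cfiTarget₁ 1 (by decide)) (cfiTarget₂ 1 (by decide)) =
      (cfiGraph 1).commonNeighbors (cfiTarget₁ 1 (by decide)) (cfiTarget₂ 1 (by decide)) ∧
    layerBetti (cfiGraph 0) (cfiTarget₁ 0 (by decide)) (cfiTarget₂ 0 (by decide)) = 2 ∧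
    layerBetti (cfiGraph 1) (cfiTarget₁ 1 (by decide)) (cfiTarget₂ 1 (by decide)) = 1 := by
  have hadj₀ := adj_cfiTargets 0 (by decide)
  have hadj₁ := adj_cfiTargets 1 (by decide)
  have hdiff : ∀ k, 1 ≤ k → ∀ x y : CFINode 1, (cfiGraph 1).Adj x y →
      pairDiagram (cfiGraph 0) k (cfiTarget₁ 0 (by decide)) (cfiTarget₂ 0 (by decide)) ≠
        pairDiagram (cfiGraph 1) k x y := by
    intro k hk x y hxy heq
    have h := congr_fun heq (5 / 2, 3 / 2)
    rw [pairDiagram_layerTwo hadj₀ hk, pairDiagram_layerTwo hxy hk, finrank_cyclesOn_untwisted,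
      finrank_cyclesOn_twisted hxy] at h
    omega
  refine ⟨by decide +kernel, by decide +kernel, not_wlDistinguishes_cfiGraph,
    fun k hk => ⟨fun heq => ?_, hdiff k hk _ _ hadj₁⟩, layerTwo_eq_commonNeighbors hadj₀,
    layerTwo_eq_commonNeighbors hadj₁, ?_, ?_⟩
  · have hmem := Multiset.mem_map_of_mem
      (fun p : CFINode 0 × CFINode 0 => pairDiagram (cfiGraph 0) k p.1 p.2)
      (Finset.mem_univ_val (cfiTarget₁ 0 (by decide), cfiTarget₂ 0 (by decide)))
    rw [heq] at hmem
    obtain ⟨⟨x, y⟩, -, hp⟩ := Multiset.mem_map.1 hmem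
    have hp' : pairDiagram (cfiGraph 1) k x y =
      pairDiagram (cfiGraph 0) k (cfiTarget₁ 0 (by decide)) (cfiTarget₂ 0 (by decide)) := hp
    -- The matching pair inherits the point (1, 3/2), hence is adjacent, and its Betti number 1
    -- contradicts 2.
    refine hdiff k hk x y ((pairDiagram_one_ne_zero_iff hk).1 ?_) hp'.symm
    rw [hp']
    exact (pairDiagram_one_ne_zero_iff hk).2 hadj₀
  · rw [layerBetti_eq hadj₀, finrank_cyclesOn_untwisted]
  · rw [layerBetti_eq hadj₁, finrank_cyclesOn_twisted hadj₁]
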